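/- Let $N\ge 3$ and let $\Omega\subset\mathbb{R}^N$ be a bounded Lipschitz domain (open, connected, nonempty, and near each boundary point, in suitable rectangular coordinates $(x,z)\in\mathbb{R}^{N-1}\times\mathbb{R}$, the region above the graph of a Lipschitz function). Let $\Gamma=\partial\Omega$ carry the $(N-1)$-dimensional Hausdorff measure $\sigma$, and let $\Gamma_1,\Gamma_2\subset\Gamma$ satisfy $\Gamma_1\cap\Gamma_2=\emptyset$, $\overline{\Gamma}_1\cup\Gamma_2=\Gamma_1\cup\overline{\Gamma}_2=\Gamma$ and $\sigma(\Gamma_1)>0$. Let $H^1(\Omega)=W^{1,2}(\Omega)$, let $H^{1/2}(\Gamma)\subset L^2(\Gamma)$ be the space of traces of functions in $H^1(\Omega)$ with the quotient norm, let $H^{1/2}(\Gamma_1)$ be the space of restrictions to $\Gamma_1$ of elements of $H^{1/2}(\Gamma)$, let $\widetilde H^{1/2}(\Gamma_2)=\{g\in H^{1/2}(\Gamma):\operatorname{supp} g\subset\overline{\Gamma}_2\}$, and let $H^{-1/2}(\Gamma_2)=(\widetilde H^{1/2}(\Gamma_2))^*$. Let $f_1\in H^{1/2}(\Gamma_1)$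 and $f_2\in H^{-1/2}(\Gamma_2)$. Let $(\mu_n)\subset L^\infty(\Omega)$ be a sequence that either has bounded total variation, $\sup_n\int_\Omega|\mu_n|\,dx<\infty$, or converges weakly-$*$ to some finite signed Radon measure $\mu$, that is, $\int_\Omega g\,\mu_n\,dx\to\int_\Omega g\,d\mu$ for all $g\in C(\overline\Omega)$. For each $n$ let $u_n\in H^1(\Omega)$ be a solution of $$-\Delta u_n=\mu_n\ \text{in }\Omega,\qquad u_n=f_1\ \text{on }\Gamma_1,\qquad \frac{\partial u_n}{\partial\hat n}=f_2\ \text{on }\Gamma_2,$$ that is, the trace of $u_n$ equals $f_1$ $\sigma$-almost everywhere on $\Gamma_1$, and $$\int_\Omega\nabla u_n\cdot\nabla v\,dx=\int_\Omega v\,\mu_n\,dx+\langle f_2,v|_\Gamma\rangle_{\Gamma_2}$$ for all $v\in H^1(\Omega)$ with trace $v|_\Gamma\in\widetilde H^{1/2}(\Gamma_2)$. Then for every $q$ with $1\le q<\frac{N}{N-1}$ the sequence $(u_n)$ is bounded in $W^{1,q}(\Omega)$: every $u_n$ is in $W^{1,q}(\Omega)$, and there is a constant $C$ with $\|u_n\|_{L^q(\Omega)}+\sum_{i=1}^N\|\partial_i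 u_n\|_{L^q(\Omega)}\le C$ for all $n$. -/

import Mathlib

open MeasureTheory Filter Topology Set
open scoped ENNReal NNReal ContDiff

noncomputable section

namespace MixedPoisson

/-- Euclidean space `ℝ^N`. -/
abbrev E (N : ℕ) := EuclideanSpace ℝ (Fin N)

/-- Lipschitz open sets: near every boundary point `P` there are rectangular coordinates
`(x, z) ∈ ℝ^(N-1) × ℝ` in which the set is the region above the graph of a Lipschitz function.
(The origin of the coordinates is kept: a translation can be absorbed into the function.) -/
def IsLipschitzSet {N : ℕ} (Ω : Set (E N)) : Prop :=
  ∀ P ∈ frontier Ω,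
    ∃ (A : E N ≃ₗᵢ[ℝ] WithLp 2 (E (N - 1) × ℝ)) (U : Set (E N)) (γ : E (N - 1) → ℝ) (L : ℝ≥0),
      IsOpen U ∧ P ∈ U ∧ LipschitzWith L γ ∧
        U ∩ Ω = U ∩ {y | γ (A y).fst < (A y).snd}

/-- Bounded Lipschitz domains (nonempty, open, connected). -/
structure IsBoundedLipschitzDomain {N : ℕ} (Ω : Set (E N)) : Prop where
  isOpen : IsOpen Ω
  isConnected : IsConnected Ω
  isBounded : Bornology.IsBounded Ω
  isLipschitz : IsLipschitzSet Ω

/-- The surface measure of `∂Ω`: the `(N-1)`-dimensional Hausdorff measure on the boundary. -/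
def surf {N : ℕ} (Ω : Set (E N)) : Measure (E N) :=
  (Measure.hausdorffMeasure ((N : ℝ) - 1)).restrict (frontier Ω)

/-- The decomposition of the boundary into a Dirichlet part `Γ₁` and a Neumann part `Γ₂`. -/
structure IsBoundaryDecomposition {N : ℕ} (Ω Γ₁ Γ₂ : Set (E N)) : Prop where
  disjoint : Disjoint Γ₁ Γ₂
  closure_left : closure Γ₁ ∪ Γ₂ = frontier Ω
  closure_right : Γ₁ ∪ closure Γ₂ = frontier Ω

/-- `G` is the weak gradient of `u` in `Ω`. -/
structure HasWeakGradient {N : ℕ} (Ω : Set (E N)) (u : E N → ℝ) (G : E N → E N) : Prop where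
  locInt : LocallyIntegrableOn u Ω
  locIntGrad : LocallyIntegrableOn G Ω
  eq : ∀ φ : E N → ℝ, ContDiff ℝ ∞ φ → HasCompactSupport φ → tsupport φ ⊆ Ω → ∀ i : Fin N,
    ∫ x in Ω, u x * fderiv ℝ φ x (EuclideanSpace.single i 1) = - ∫ x in Ω, G x i * φ x

/-- The Sobolev space `W^{1,p}(Ω)`. -/
def MemW1 {N : ℕ} (Ω : Set (E N)) (p : ℝ≥0∞) (u : E N → ℝ) : Prop :=
  MemLp u p (volume.restrict Ω) ∧
    ∃ G, HasWeakGradient Ω u G ∧ MemLp G p (volume.restrict Ω)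

/-- The norm `‖u‖_p + ∑ᵢ ‖∂ᵢ u‖_p` of `W^{1,p}(Ω)`. The weak gradient is unique up to null sets, so
the infimum is the value at the weak gradient; it is `∞` if `u` has no weak gradient. -/
def w1Norm {N : ℕ} (Ω : Set (E N)) (p : ℝ≥0∞) (u : E N → ℝ) : ℝ≥0∞ :=
  ⨅ (G : E N → E N) (_ : HasWeakGradient Ω u G),
    eLpNorm u p (volume.restrict Ω) + ∑ i, eLpNorm (fun x => G x i) p (volume.restrict Ω)

/-- `g ∈ L²(∂Ω)` is the trace of `u ∈ H¹(Ω) = W^{1,2}(Ω)` on `∂Ω`: the trace operator is the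
continuous extension of `φ ↦ φ|_{∂Ω}` from `C¹(Ω̄)` to `H¹(Ω)`. -/
def HasTrace {N : ℕ} (Ω : Set (E N)) (u : E N → ℝ) (g : Lp ℝ 2 (surf Ω)) : Prop :=
  MemW1 Ω 2 u ∧ ∃ φ : ℕ → E N → ℝ, (∀ k, ContDiff ℝ 1 (φ k)) ∧
    Tendsto (fun k => w1Norm Ω 2 (fun x => φ k x - u x)) atTop (𝓝 0) ∧
    Tendsto (fun k => eLpNorm (fun x => φ k x - g x) 2 (surf Ω)) atTop (𝓝 0)

lemma integrable_smul_test {N : ℕ} {Ω : Set (E N)} {u : E N → ℝ}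
    (hu : LocallyIntegrableOn u Ω) {ψ : E N → ℝ}
    (hψ : Continuous ψ) (hc : HasCompactSupport ψ) (hs : tsupport ψ ⊆ Ω) :
    Integrable (fun x => u x * ψ x) (volume.restrict Ω) := by
  have hK : IsCompact (tsupport ψ) := hc
  have h1 : IntegrableOn u (tsupport ψ) volume := hu.integrableOn_compact_subset hs hK
  have h2 : IntegrableOn (fun x => u x * ψ x) (tsupport ψ) volume :=
    h1.mul_continuousOn hψ.continuousOn hK
  have h3 : Integrable (fun x => u x * ψ x) volume :=
    (integrableOn_iff_integrable_of_support_subset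
      (fun x hx => subset_tsupport ψ (by
        intro h0
        apply hx
        simp [h0]))).1 h2
  exact h3.restrict

lemma integrable_left {N : ℕ} {Ω : Set (E N)} {u : E N → ℝ}
    (h : LocallyIntegrableOn u Ω) {φ : E N → ℝ} (h1 : ContDiff ℝ ∞ φ)
    (h2 : HasCompactSupport φ) (h3 : tsupport φ ⊆ Ω) (i : Fin N) :
    Integrable (fun x => u x * fderiv ℝ φ x (EuclideanSpace.single i 1))
      (volume.restrict Ω) :=
  integrable_smul_test h
    ((h1.continuous_fderiv (by simp)).clm_apply continuous_const)
    (h2.fderiv_apply (𝕜 := ℝ) _) ((tsupport_fderiv_apply_subset ℝ _).trans h3)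

lemma locallyIntegrableOn_coord {N : ℕ} {Ω : Set (E N)} {G : E N → E N}
    (h : LocallyIntegrableOn G Ω) (i : Fin N) : LocallyIntegrableOn (fun x => G x i) Ω := by
  intro x hx
  obtain ⟨t, ht, hG⟩ := h x hx
  exact ⟨t, ht, (EuclideanSpace.proj i : E N →L[ℝ] ℝ).integrable_comp hG⟩

lemma integrable_right {N : ℕ} {Ω : Set (E N)} {G : E N → E N}
    (h : LocallyIntegrableOn G Ω) {φ : E N → ℝ} (h1 : ContDiff ℝ ∞ φ)
    (h2 : HasCompactSupport φ) (h3 : tsupport φ ⊆ Ω) (i : Fin N) :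
    Integrable (fun x => G x i * φ x) (volume.restrict Ω) :=
  integrable_smul_test (locallyIntegrableOn_coord h i) h1.continuous h2 h3

lemma HasWeakGradient.add {N : ℕ} {Ω : Set (E N)} {u v : E N → ℝ} {G H : E N → E N}
    (hu : HasWeakGradient Ω u G) (hv : HasWeakGradient Ω v H) :
    HasWeakGradient Ω (fun x => u x + v x) (fun x => G x + H x) where
  locInt := hu.locInt.add hv.locInt
  locIntGrad := hu.locIntGrad.add hv.locIntGrad
  eq φ h1 h2 h3 i := by
    simp only [add_mul, PiLp.add_apply]
    rw [integral_add (integrable_left hu.locInt h1 h2 h3 i) (integrable_left hv.locInt h1 h2 h3 i),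
      integral_add (integrable_right hu.locIntGrad h1 h2 h3 i)
        (integrable_right hv.locIntGrad h1 h2 h3 i), hu.eq φ h1 h2 h3 i, hv.eq φ h1 h2 h3 i]
    ring

lemma HasWeakGradient.const_smul {N : ℕ} {Ω : Set (E N)} {u : E N → ℝ} {G : E N → E N}
    (hu : HasWeakGradient Ω u G) (c : ℝ) :
    HasWeakGradient Ω (fun x => c * u x) (fun x => c • G x) where
  locInt := hu.locInt.smul c
  locIntGrad := hu.locIntGrad.smul c
  eq φ h1 h2 h3 i := by
    simp only [mul_assoc, PiLp.smul_apply, smul_eq_mul]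
    rw [integral_const_mul, integral_const_mul, hu.eq φ h1 h2 h3 i]
    ring

lemma hasWeakGradient_zero {N : ℕ} (Ω : Set (E N)) :
    HasWeakGradient Ω (fun _ => 0) (fun _ => 0) where
  locInt := locallyIntegrableOn_zero
  locIntGrad := locallyIntegrableOn_zero
  eq φ h1 h2 h3 i := by simp

lemma w1Norm_zero {N : ℕ} (Ω : Set (E N)) (p : ℝ≥0∞) : w1Norm Ω p (fun _ => 0) = 0 := by
  refine le_antisymm (iInf₂_le_of_le _ (hasWeakGradient_zero Ω) ?_) zero_le
  simp

lemma w1Norm_add_le {N : ℕ} {Ω : Set (E N)} {p : ℝ≥0∞} (hp : 1 ≤ p) (u v : E N → ℝ) :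
    w1Norm Ω p (fun x => u x + v x) ≤ w1Norm Ω p u + w1Norm Ω p v := by
  rw [w1Norm, w1Norm, w1Norm]
  simp only [ENNReal.iInf_add, ENNReal.add_iInf]
  refine le_iInf₂ fun H hH => le_iInf₂ fun G hG => ?_
  refine iInf₂_le_of_le _ (hG.add hH) ?_
  rw [add_add_add_comm, ← Finset.sum_add_distrib]
  refine add_le_add
    (eLpNorm_add_le hG.locInt.aestronglyMeasurable hH.locInt.aestronglyMeasurable hp)
    (Finset.sum_le_sum fun i _ => ?_)
  exact eLpNorm_add_le (locallyIntegrableOn_coord hG.locIntGrad i).aestronglyMeasurable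
    (locallyIntegrableOn_coord hH.locIntGrad i).aestronglyMeasurable hp

lemma w1Norm_const_mul_le {N : ℕ} {Ω : Set (E N)} {p : ℝ≥0∞} (c : ℝ) (u : E N → ℝ) :
    w1Norm Ω p (fun x => c * u x) ≤ ‖c‖ₑ * w1Norm Ω p u := by
  rcases eq_or_ne c 0 with rfl | hc
  · simp [w1Norm_zero]
  have hc' : ‖c‖ₑ ≠ 0 := by simpa using hc
  rw [w1Norm, w1Norm]
  simp only [ENNReal.mul_iInf_of_ne hc' enorm_ne_top]
  refine le_iInf₂ fun G hG => iInf₂_le_of_le _ (hG.const_smul c) ?_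
  rw [mul_add, Finset.mul_sum]
  refine add_le_add (le_of_eq (eLpNorm_const_smul c u p _)) (Finset.sum_le_sum fun i _ => ?_)
  exact le_of_eq (eLpNorm_const_smul c (fun x => G x i) p _)

lemma MemW1.add {N : ℕ} {Ω : Set (E N)} {p : ℝ≥0∞} {u v : E N → ℝ}
    (hu : MemW1 Ω p u) (hv : MemW1 Ω p v) : MemW1 Ω p (fun x => u x + v x) := by
  obtain ⟨hu, G, hG, hG'⟩ := hu
  obtain ⟨hv, H, hH, hH'⟩ := hv
  exact ⟨hu.add hv, _, hG.add hH, hG'.add hH'⟩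

lemma MemW1.const_mul {N : ℕ} {Ω : Set (E N)} {p : ℝ≥0∞} {u : E N → ℝ}
    (hu : MemW1 Ω p u) (c : ℝ) : MemW1 Ω p (fun x => c * u x) := by
  obtain ⟨hu, G, hG, hG'⟩ := hu
  exact ⟨hu.const_mul c, _, hG.const_smul c, hG'.const_smul c⟩

lemma HasTrace.add {N : ℕ} {Ω : Set (E N)} {u v : E N → ℝ} {g h : Lp ℝ 2 (surf Ω)}
    (hu : HasTrace Ω u g) (hv : HasTrace Ω v h) : HasTrace Ω (fun x => u x + v x) (g + h) := by
  obtain ⟨hu, φ, hφ, hφu, hφg⟩ := hu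
  obtain ⟨hv, ψ, hψ, hψv, hψh⟩ := hv
  refine ⟨hu.add hv, fun k x => φ k x + ψ k x, fun k => (hφ k).add (hψ k), ?_, ?_⟩
  · refine tendsto_of_tendsto_of_tendsto_of_le_of_le tendsto_const_nhds
      (by simpa using hφu.add hψv) (fun _ => zero_le) (fun k => ?_)
    simp only [add_sub_add_comm]
    exact w1Norm_add_le (by norm_num) _ _
  · refine tendsto_of_tendsto_of_tendsto_of_le_of_le tendsto_const_nhds
      (by simpa using hφg.add hψh) (fun _ => zero_le) (fun k => ?_)
    have hae : (fun x => φ k x + ψ k x - (g + h : Lp ℝ 2 (surf Ω)) x) =ᵐ[surf Ω]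
        (fun x => φ k x - g x) + (fun x => ψ k x - h x) := by
      filter_upwards [Lp.coeFn_add g h] with x hx
      simp only [hx, Pi.add_apply, add_sub_add_comm]
    refine (eLpNorm_congr_ae hae).trans_le (eLpNorm_add_le ?_ ?_ (by norm_num))
    · exact (hφ k).continuous.aestronglyMeasurable.sub (Lp.aestronglyMeasurable g)
    · exact (hψ k).continuous.aestronglyMeasurable.sub (Lp.aestronglyMeasurable h)

lemma HasTrace.const_smul {N : ℕ} {Ω : Set (E N)} {u : E N → ℝ} {g : Lp ℝ 2 (surf Ω)}
    (hu : HasTrace Ω u g) (c : ℝ) : HasTrace Ω (fun x => c * u x) (c • g) := by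
  obtain ⟨hu, φ, hφ, hφu, hφg⟩ := hu
  refine ⟨hu.const_mul c, fun k x => c * φ k x, fun k => contDiff_const.mul (hφ k), ?_, ?_⟩
  · refine tendsto_of_tendsto_of_tendsto_of_le_of_le tendsto_const_nhds
      (by simpa using ENNReal.Tendsto.const_mul hφu (Or.inr (enorm_ne_top (x := c))))
      (fun _ => zero_le) (fun k => ?_)
    simp only [← mul_sub]
    exact w1Norm_const_mul_le c _
  · refine tendsto_of_tendsto_of_tendsto_of_le_of_le tendsto_const_nhds
      (by simpa using ENNReal.Tendsto.const_mul hφg (Or.inr (enorm_ne_top (x := c))))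
      (fun _ => zero_le) (fun k => ?_)
    have hae : (fun x => c * φ k x - (c • g : Lp ℝ 2 (surf Ω)) x) =ᵐ[surf Ω]
        c • (fun x => φ k x - g x) := by
      filter_upwards [Lp.coeFn_smul c g] with x hx
      simp [hx, mul_sub]
    exact ((eLpNorm_congr_ae hae).trans (eLpNorm_const_smul c _ _ _)).le

lemma hasTrace_zero {N : ℕ} (Ω : Set (E N)) : HasTrace Ω (fun _ => 0) 0 := by
  refine ⟨⟨MemLp.zero', _, hasWeakGradient_zero Ω, MemLp.zero'⟩, fun _ _ => 0,
    fun _ => contDiff_const, ?_, ?_⟩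
  · simp [w1Norm_zero]
  · have hae : (fun x => (0 : ℝ) - (0 : Lp ℝ 2 (surf Ω)) x) =ᵐ[surf Ω] fun _ => 0 := by
      filter_upwards [Lp.coeFn_zero ℝ 2 (surf Ω)] with x hx
      rw [hx, Pi.zero_apply, sub_zero]
    simp only [eLpNorm_congr_ae hae, eLpNorm_zero']
    exact tendsto_const_nhds

/-- The space `H^{1/2}(∂Ω)`: the traces on `∂Ω` of the functions in `H¹(Ω)`. -/
def HHalf {N : ℕ} (Ω : Set (E N)) : Submodule ℝ (Lp ℝ 2 (surf Ω)) where
  carrier := {g | ∃ u, HasTrace Ω u g}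
  zero_mem' := ⟨_, hasTrace_zero Ω⟩
  add_mem' := fun ⟨_, hu⟩ ⟨_, hv⟩ => ⟨_, hu.add hv⟩
  smul_mem' := fun c _ ⟨_, hu⟩ => ⟨_, hu.const_smul c⟩

/-- The norm of `H^{1/2}(∂Ω)`: the least `H¹(Ω)` norm of a function with the given trace. -/
def hHalfNorm {N : ℕ} (Ω : Set (E N)) (g : Lp ℝ 2 (surf Ω)) : ℝ≥0∞ :=
  ⨅ (u : E N → ℝ) (_ : HasTrace Ω u g), w1Norm Ω 2 u

/-- `f ∈ H^{1/2}(Γ₁)`: on `Γ₁`, `f` is the restriction of an element of `H^{1/2}(∂Ω)`. -/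
def MemHHalfOn {N : ℕ} (Ω Γ₁ : Set (E N)) (f : E N → ℝ) : Prop :=
  ∃ g ∈ HHalf Ω, g =ᵐ[(surf Ω).restrict Γ₁] f

/-- The space `H̃^{1/2}(Γ₂)`: the elements of `H^{1/2}(∂Ω)` with support in the closure of `Γ₂`,
that is, vanishing almost everywhere outside this closed set. -/
def HTildeHalf {N : ℕ} (Ω Γ₂ : Set (E N)) : Submodule ℝ (Lp ℝ 2 (surf Ω)) where
  carrier := {g | g ∈ HHalf Ω ∧ ∀ᵐ x ∂(surf Ω), x ∉ closure Γ₂ → g x = 0}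
  zero_mem' := by
    refine ⟨(HHalf Ω).zero_mem, ?_⟩
    filter_upwards [Lp.coeFn_zero ℝ 2 (surf Ω)] with x hx _
    rw [hx, Pi.zero_apply]
  add_mem' := by
    rintro g h ⟨hg, hg'⟩ ⟨hh, hh'⟩
    refine ⟨(HHalf Ω).add_mem hg hh, ?_⟩
    filter_upwards [Lp.coeFn_add g h, hg', hh'] with x hx h1 h2 hxc
    rw [hx, Pi.add_apply, h1 hxc, h2 hxc, add_zero]
  smul_mem' := by
    rintro c g ⟨hg, hg'⟩
    refine ⟨(HHalf Ω).smul_mem c hg, ?_⟩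
    filter_upwards [Lp.coeFn_smul c g, hg'] with x hx h1 hxc
    simp [hx, h1 hxc]

/-- The space `H^{-1/2}(Γ₂)`: the dual space of `H̃^{1/2}(Γ₂)`, that is, the linear functionals
that are bounded for the norm of `H^{1/2}(∂Ω)`. -/
structure HNegHalf {N : ℕ} (Ω Γ₂ : Set (E N)) where
  toLinearMap : HTildeHalf Ω Γ₂ →ₗ[ℝ] ℝ
  bounded : ∃ C : ℝ≥0, ∀ h : HTildeHalf Ω Γ₂, ‖toLinearMap h‖ₑ ≤ C * hHalfNorm Ω h

/-- `u ∈ H¹(Ω)` is a solution of the mixed problem `-Δu = ρ` in `Ω`, `u = f₁` on `Γ₁`,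
`∂u/∂n = f₂` on `Γ₂`. The Dirichlet condition is understood through the trace. The equation and
the Neumann condition (equality in `H^{-1/2}(Γ₂)`) are expressed together by Green's formula, for
all `v ∈ H¹(Ω)` whose trace `h` is in `H̃^{1/2}(Γ₂)`; test functions with `h = 0` give the
equation in `Ω`. -/
structure IsMixedSolution {N : ℕ} (Ω Γ₁ Γ₂ : Set (E N)) (ρ f₁ : E N → ℝ) (f₂ : HNegHalf Ω Γ₂)
    (u : E N → ℝ) : Prop where
  memH1 : MemW1 Ω 2 u
  dirichlet : ∃ g : Lp ℝ 2 (surf Ω), HasTrace Ω u g ∧ g =ᵐ[(surf Ω).restrict Γ₁] f₁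
  weak : ∃ G, HasWeakGradient Ω u G ∧
    ∀ (v : E N → ℝ) (H : E N → E N) (h : HTildeHalf Ω Γ₂),
      HasWeakGradient Ω v H → HasTrace Ω v h →
        ∫ x in Ω, inner ℝ (G x) (H x) = (∫ x in Ω, v x * ρ x) + f₂.toLinearMap h

/-- The densities `μ n` have bounded total variation `∫_Ω |μ n|`. -/
def BoundedVariation {N : ℕ} (Ω : Set (E N)) (μ : ℕ → E N → ℝ) : Prop :=
  ∃ M : ℝ≥0, ∀ n, eLpNorm (μ n) 1 (volume.restrict Ω) ≤ M

/-- The integral `∫_Ω g dν` against a finite signed measure. -/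
def signedIntegral {N : ℕ} (Ω : Set (E N)) (ν : SignedMeasure (E N)) (g : E N → ℝ) : ℝ :=
  (∫ x in Ω, g x ∂ν.toJordanDecomposition.posPart) -
    ∫ x in Ω, g x ∂ν.toJordanDecomposition.negPart

/-- The densities `μ n` converge weakly-* to the finite signed measure `ν`:
`∫_Ω g μ_n → ∫_Ω g dν` for all `g ∈ C(Ω̄)`. -/
def WeakStarTendsto {N : ℕ} (Ω : Set (E N)) (μ : ℕ → E N → ℝ) (ν : SignedMeasure (E N)) : Prop :=
  ∀ g : E N → ℝ, ContinuousOn g (closure Ω) →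
    Tendsto (fun n => ∫ x in Ω, g x * μ n x) atTop (𝓝 (signedIntegral Ω ν g))

end MixedPoisson

end

noncomputable section

namespace MixedPoisson

/-! This is the Boccardo–Gallouët method for elliptic equations with measure data. The difference `z
= u_n - u_0` has zero trace on `Γ₁`, and the functional `f₂` cancels in its weak equation, so only
the `L¹` norms of the sources remain. For a bounded `Ψ ∈ C¹` with bounded derivative and `Ψ 0 = 0`,
the function `Ψ(z)` is admissible and gives `∫ Ψ'(z)|∇z|² ≤ sup|Ψ| (‖μ_n‖₁ + ‖μ_0‖₁)`
(`IsMixedSolution.exists_energy_le`).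

Take `Ψ' = (1 + s²)^(-2β)` with `1/4 < β < 1/2`: the primitive is bounded because `2β > 1/2`, and
the left side is `‖∇w‖₂²` for `w = bracketPrim β (z)`. Since `w` vanishes on `Γ₁`, a
Poincaré–Sobolev inequality bounds `w` in `Lᵖ` for every `2 ≤ p < 2N/(N-2)`. As `|w|` grows at least
like `|z|^(1-2β)`, this bounds `(1 + z²)^β` in `Lᵐ` with `mκ = p`, `κ = β/(1/2-β)`. Hölder's
inequality for `∇z = (1 + z²)^β · ∇w` then bounds `∇z` in `L^q`, `1/q = 1/m + 1/2`. The choice of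
exponents in `exists_exponents` is possible because `q < N/(N-1)` says exactly that `m < 2N/(N-2)`.
Finally `u_0` is one fixed element of `H¹ ⊆ W^{1,q}`.

The Poincaré–Sobolev inequality (`poincare_sobolev_of_hasTrace`) is proved first for `C¹` functions
on pieces of `Ω` that are star-shaped with respect to a ball, by a Riesz potential bound and Young's
inequality. Connectedness of `closure Ω` links the averages over the pieces, a trace inequality on
Lipschitz graphs brings in the boundary values, and the `C¹` approximation that defines the trace
carries the result to `H¹`.

If the sources are only known to converge weakly-*, Banach–Steinhaus provides the `L¹` bound
(`WeakStarTendsto.boundedVariation`). -/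

/-! ### Young's inequality and Riesz potentials -/

/-- Young's convolution inequality `L² * Lʳ ⊆ Lᵖ`, `1 / r = 1 / 2 + 1 / p`. -/
lemma lintegral_lconvolution_rpow_le {N : ℕ} {f k : E N → ℝ≥0∞} (hf : Measurable f)
    (hk : Measurable k) {p r : ℝ} (hp : 2 ≤ p) (hr : 1 / r = 1 / 2 + 1 / p) :
    ∫⁻ x, (∫⁻ y, f y * k (y - x)) ^ p ≤
      (∫⁻ y, f y ^ (2 : ℝ)) ^ (p / 2) * (∫⁻ z, k z ^ r) ^ (p / 2 + 1) := by
  have hp0 : 0 < p := by linarith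
  have hrpos : 0 < r := by
    have : 0 < 1 / r := by rw [hr]; positivity
    exact one_div_pos.1 this
  have hrp : r / p + r / 2 = 1 := by
    have h : r * (1 / r) = r * (1 / 2 + 1 / p) := by rw [hr]
    rw [mul_one_div_cancel hrpos.ne'] at h
    rw [h]; ring
  set a := ∫⁻ y, f y ^ (2 : ℝ) with ha
  set κ := ∫⁻ z, k z ^ r with hκ
  have hκx : ∀ x, ∫⁻ y, k (y - x) ^ r = κ := fun x =>
    lintegral_sub_right_eq_self (fun z => k z ^ r) x
  have hκy : ∀ y, ∫⁻ x, k (y - x) ^ r = κ := fun y =>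
    lintegral_sub_left_eq_self (fun z => k z ^ r) y
  have hkm : Measurable fun z : E N × E N => k (z.2 - z.1) :=
    hk.comp (measurable_snd.sub measurable_fst)
  have hkx : ∀ x, Measurable fun y => k (y - x) := fun x => hk.comp (measurable_id.sub_const x)
  have key : ∀ x, (∫⁻ y, f y * k (y - x)) ^ p ≤
      (∫⁻ y, f y ^ (2 : ℝ) * k (y - x) ^ r) * (a ^ (p / 2 - 1) * κ ^ (p / 2)) := by
    intro x
    -- Three-factor Hölder with weights `1/p`, `1/2 - 1/p`, `1/2`, which sum to `1`; `r/p + r/2 = 1`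
    -- restores the exponent of `k`. Only the first factor couples `f` and `k`, and its power `p`
    -- integrates to `a * κ` by Tonelli.
    have h1 : ∀ y, f y * k (y - x) = (f y ^ (2 : ℝ) * k (y - x) ^ r) ^ (1 / p) *
        ((f y ^ (2 : ℝ)) ^ (1 / 2 - 1 / p) * (k (y - x) ^ r) ^ (1 / 2 : ℝ)) := by
      intro y
      have e1 : 0 ≤ 2 * (1 / p) := by positivity
      have e2 : 0 ≤ 2 * (1 / 2 - 1 / p) := by
        have : 1 / p ≤ 1 / 2 := one_div_le_one_div_of_le (by norm_num) hp
        linarith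
      rw [ENNReal.mul_rpow_of_nonneg _ _ (by positivity), ← ENNReal.rpow_mul, ← ENNReal.rpow_mul,
        ← ENNReal.rpow_mul, ← ENNReal.rpow_mul, mul_mul_mul_comm,
        ← ENNReal.rpow_add_of_nonneg _ _ e1 e2,
        ← ENNReal.rpow_add_of_nonneg _ _ (by positivity) (by positivity)]
      rw [show 2 * (1 / p) + 2 * (1 / 2 - 1 / p) = (1 : ℝ) by ring,
        show r * (1 / p) + r * (1 / 2) = (1 : ℝ) by linear_combination hrp]
      simp
    have hpinv : 1 / p ≤ 1 / 2 := one_div_le_one_div_of_le (by norm_num) hp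
    have h2 := ENNReal.lintegral_prod_norm_pow_le (μ := (volume : Measure (E N)))
      (Finset.univ : Finset (Fin 3))
      (f := ![fun y => f y ^ (2 : ℝ) * k (y - x) ^ r, fun y => f y ^ (2 : ℝ),
        fun y => k (y - x) ^ r]) (p := ![1 / p, 1 / 2 - 1 / p, 1 / 2])
      (by
        intro i _
        have := hkx x
        fin_cases i <;> simp <;> fun_prop)
      (by simp [Fin.sum_univ_three]; norm_num)
      (by
        intro i _
        fin_cases i
        · simp; positivity
        · simpa using hpinv
        · simp)
    simp only [Fin.prod_univ_three, Matrix.cons_val_zero, Matrix.cons_val_one,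
      Matrix.cons_val] at h2
    rw [hκx x, ← ha] at h2
    have h3 : ∫⁻ y, f y * k (y - x) ≤ (∫⁻ y, f y ^ (2 : ℝ) * k (y - x) ^ r) ^ (1 / p) *
        a ^ (1 / 2 - 1 / p) * κ ^ (1 / 2 : ℝ) := by
      refine le_trans (le_of_eq (lintegral_congr fun y => ?_)) h2
      rw [h1 y, mul_assoc]
    refine (ENNReal.rpow_le_rpow h3 hp0.le).trans (le_of_eq ?_)
    rw [ENNReal.mul_rpow_of_nonneg _ _ hp0.le, ENNReal.mul_rpow_of_nonneg _ _ hp0.le,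
      ← ENNReal.rpow_mul, ← ENNReal.rpow_mul, ← ENNReal.rpow_mul, one_div_mul_cancel hp0.ne',
      ENNReal.rpow_one, mul_assoc]
    congr 3
    · field_simp
    · ring
  calc ∫⁻ x, (∫⁻ y, f y * k (y - x)) ^ p
      ≤ ∫⁻ x, (∫⁻ y, f y ^ (2 : ℝ) * k (y - x) ^ r) * (a ^ (p / 2 - 1) * κ ^ (p / 2)) :=
        lintegral_mono key
    _ = (∫⁻ x, ∫⁻ y, f y ^ (2 : ℝ) * k (y - x) ^ r) * (a ^ (p / 2 - 1) * κ ^ (p / 2)) := by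
        refine lintegral_mul_const _ ?_
        exact Measurable.lintegral_prod_right
          (((hf.comp measurable_snd).pow_const _).mul (hkm.pow_const _))
    _ = (a * κ) * (a ^ (p / 2 - 1) * κ ^ (p / 2)) := by
        rw [lintegral_lintegral_swap]
        · congr 1
          have : ∀ y, ∫⁻ x, f y ^ (2 : ℝ) * k (y - x) ^ r = f y ^ (2 : ℝ) * κ := by
            intro y
            have hm : Measurable fun x => k (y - x) ^ r :=
              (hk.comp (measurable_const.sub measurable_id)).pow_const _
            rw [lintegral_const_mul _ hm, hκy]
          simp only [this]
          rw [lintegral_mul_const _ (hf.pow_const _)]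
        · exact (((hf.comp measurable_snd).pow_const _).mul (hkm.pow_const _)).aemeasurable
    _ = a ^ (p / 2) * κ ^ (p / 2 + 1) := by
        have e1 : a ^ (p / 2) = a * a ^ (p / 2 - 1) := by
          conv_rhs => rw [← ENNReal.rpow_one a, ← ENNReal.rpow_mul, one_mul]
          rw [← ENNReal.rpow_add_of_nonneg _ _ (by norm_num) (by linarith)]
          congr 1; ring
        have e2 : κ ^ (p / 2 + 1) = κ * κ ^ (p / 2) := by
          rw [ENNReal.rpow_add_of_nonneg _ _ (by linarith) (by norm_num), ENNReal.rpow_one, mul_comm]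
        rw [e1, e2]; ring

/-- The increment of a `C¹` function along a segment. -/
lemma enorm_sub_le_lintegral_fderiv {N : ℕ} {φ : E N → ℝ} (hφ : ContDiff ℝ 1 φ) (x v : E N)
    {T : ℝ} (hT : 0 ≤ T) :
    ‖φ (x + T • v) - φ x‖ₑ ≤ ‖v‖ₑ * ∫⁻ t in Ioo 0 T, ‖fderiv ℝ φ (x + t • v)‖ₑ := by
  have hd : ∀ t : ℝ, HasDerivAt (fun t : ℝ => φ (x + t • v)) (fderiv ℝ φ (x + t • v) v) t := by
    intro t
    have h1 : HasDerivAt (fun t : ℝ => x + t • v) v t := by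
      simpa using ((hasDerivAt_id t).smul_const v).const_add x
    exact ((hφ.differentiable (by norm_num)) _).hasFDerivAt.comp_hasDerivAt t h1
  have hc : Continuous fun t : ℝ => fderiv ℝ φ (x + t • v) v :=
    ((hφ.continuous_fderiv (by norm_num)).comp (by fun_prop)).clm_apply continuous_const
  have h := intervalIntegral.integral_eq_sub_of_hasDerivAt (a := 0) (b := T)
    (fun t _ => hd t) (hc.intervalIntegrable _ _)
  simp only [zero_smul, add_zero] at h
  rw [← h, intervalIntegral.integral_of_le hT, integral_Ioc_eq_integral_Ioo]
  refine (enorm_integral_le_lintegral_enorm _).trans ?_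
  rw [← lintegral_const_mul' _ _ enorm_ne_top]
  refine lintegral_mono fun t => ?_
  rw [mul_comm]
  exact ContinuousLinearMap.le_opENorm _ _

lemma lintegral_comp_homothety {N : ℕ} {f : E N → ℝ≥0∞} (hf : Measurable f) (x : E N) {t : ℝ}
    (ht : 0 < t) :
    ∫⁻ b, f (x + t • (b - x)) = ENNReal.ofReal (t ^ N)⁻¹ * ∫⁻ y, f y := by
  have h1 : ∫⁻ b, f (x + t • (b - x)) = ∫⁻ b, f (x + t • b) :=
    lintegral_sub_right_eq_self (fun b => f (x + t • b)) x
  have h2 : ∫⁻ b, f (x + t • b) = ∫⁻ y, f (x + y) ∂(Measure.map (fun b : E N => t • b) volume) :=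
    (lintegral_map (hf.comp (measurable_const.add measurable_id)) (measurable_const_smul t)).symm
  rw [h1, h2, Measure.map_addHaar_smul _ ht.ne', lintegral_smul_measure,
    lintegral_add_left_eq_self, abs_of_pos (by positivity)]
  simp

/-- The truncated Riesz kernel `(d / ‖z‖) ^ s` on the ball of radius `d`. -/
def rieszKernel {N : ℕ} (d s : ℝ) : E N → ℝ≥0∞ :=
  (Metric.ball 0 d).indicator fun z => (ENNReal.ofReal d / ‖z‖ₑ) ^ s

lemma measurable_rieszKernel {N : ℕ} (d s : ℝ) : Measurable (rieszKernel (N := N) d s) :=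
  ((measurable_const.div measurable_enorm).pow_const s).indicator measurableSet_ball

lemma lintegral_rieszKernel_rpow_lt_top {N : ℕ} (hN : 1 ≤ N) {d s r : ℝ}
    (hr : 0 < r) (hsr : s * r < N) : ∫⁻ z : E N, rieszKernel d s z ^ r < ⊤ := by
  have h1 : ∀ z : E N, rieszKernel d s z ^ r =
      (Metric.ball 0 d).indicator (fun z => (ENNReal.ofReal d / ‖z‖ₑ) ^ (s * r)) z := by
    intro z
    by_cases hz : z ∈ Metric.ball (0 : E N) d
    · simp [rieszKernel, hz, ENNReal.rpow_mul]
    · rw [rieszKernel, indicator_of_notMem hz, indicator_of_notMem hz, ENNReal.zero_rpow_of_pos hr]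
  simp only [h1]
  rw [lintegral_indicator measurableSet_ball]
  have hint : IntegrableOn (fun z : E N => d ^ (s * r) * ‖z‖ ^ (-(s * r))) (Metric.ball 0 d) := by
    refine integrableOn_ball_of_norm_le_rpow (by simpa using hN) (C := |d ^ (s * r)|)
      (α := s * r) (by simpa using hsr) ?_ ?_
    · refine Eventually.of_forall fun z => ?_
      rw [norm_mul, Real.norm_eq_abs, Real.norm_of_nonneg (by positivity)]
    · exact (measurable_const.mul (measurable_norm.pow_const _)).aestronglyMeasurable
  refine lt_of_le_of_lt (lintegral_mono_ae ?_) hint.2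
  have : NeZero N := ⟨by omega⟩
  have h0 : ∀ᵐ z : E N, z ≠ 0 := by
    rw [ae_iff]
    simp
  filter_upwards [ae_restrict_of_ae h0, ae_restrict_mem measurableSet_ball] with z hz hzd
  have hn : 0 < ‖z‖ := norm_pos_iff.2 hz
  have hd : 0 < d := lt_of_le_of_lt dist_nonneg hzd
  rw [← ofReal_norm, ← ENNReal.ofReal_div_of_pos hn, ENNReal.ofReal_rpow_of_pos (by positivity),
    Real.enorm_of_nonneg (by positivity), Real.div_rpow hd.le hn.le, Real.rpow_neg hn.le,
    div_eq_mul_inv]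

/-- For fixed `t`, the substitution `y = x + t(b - x)` produces `t^(-N)` and confines `y` to `‖y -
x‖ < t d`, where `t^(-N) ≤ t^(s-N) (d/‖y - x‖)^s`. This separates `t` from `y`. The factor in `t` is
finite for `s > N - 1`; the loss against the kernel of order `N - 1` is harmless for subcritical
exponents. -/
lemma lintegral_lintegral_homothety_le {N : ℕ} {f : E N → ℝ≥0∞} (hf : Measurable f) (x : E N)
    {d s : ℝ} (hs : 0 < s) :
    ∫⁻ b in Metric.ball x d, ∫⁻ t in Ioo (0 : ℝ) 1, f (x + t • (b - x)) ≤
      (∫⁻ t in Ioo (0 : ℝ) 1, ENNReal.ofReal (t ^ (s - N))) *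
        ∫⁻ y, f y * rieszKernel d s (y - x) := by
  have hm : Measurable fun z : E N × ℝ => f (x + z.2 • (z.1 - x)) :=
    hf.comp (measurable_const.add (measurable_snd.smul (measurable_fst.sub_const x)))
  rw [lintegral_lintegral_swap hm.aemeasurable, ← lintegral_mul_const _ (by fun_prop)]
  refine setLIntegral_mono' measurableSet_Ioo fun t ht => ?_
  have hball : ∀ b, (Metric.ball x d).indicator (fun b => f (x + t • (b - x))) b =
      (fun y => (Metric.ball x (t * d)).indicator f y) (x + t • (b - x)) := by
    intro b
    have : b ∈ Metric.ball x d ↔ x + t • (b - x) ∈ Metric.ball x (t * d) := by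
      rw [Metric.mem_ball, Metric.mem_ball, dist_eq_norm, dist_eq_norm, add_sub_cancel_left,
        norm_smul, Real.norm_of_nonneg ht.1.le, mul_lt_mul_iff_right₀ ht.1]
    by_cases hb : b ∈ Metric.ball x d
    · rw [indicator_of_mem hb]
      exact (indicator_of_mem (this.1 hb) f).symm
    · rw [indicator_of_notMem hb]
      exact (indicator_of_notMem (fun h => hb (this.2 h)) f).symm
  have hkx : Measurable fun y => f y * rieszKernel d s (y - x) :=
    hf.mul ((measurable_rieszKernel d s).comp (measurable_id.sub_const x))
  rw [← lintegral_indicator measurableSet_ball, lintegral_congr hball,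
    lintegral_comp_homothety (hf.indicator measurableSet_ball) x ht.1,
    ← lintegral_const_mul _ (hf.indicator measurableSet_ball),
    ← lintegral_const_mul _ hkx]
  refine lintegral_mono fun y => ?_
  by_cases hy : y ∈ Metric.ball x (t * d)
  swap
  · simp [indicator_of_notMem hy]
  rw [indicator_of_mem hy, mul_comm (f y), ← mul_assoc]
  refine mul_le_mul_left ?_ _
  have hn : ‖y - x‖ < t * d := by rwa [← dist_eq_norm]
  have hd : 0 < d := by
    have h0 : 0 < t * d := lt_of_le_of_lt (norm_nonneg _) hn
    exact pos_of_mul_pos_right h0 ht.1.le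
  have hmem : y - x ∈ Metric.ball (0 : E N) d := by
    rw [mem_ball_zero_iff]
    exact hn.trans (by nlinarith [ht.2])
  rw [rieszKernel, indicator_of_mem hmem]
  have h1 : ENNReal.ofReal t⁻¹ ≤ ENNReal.ofReal d / ‖y - x‖ₑ := by
    rw [ENNReal.le_div_iff_mul_le (Or.inr (by simpa using hd)) (Or.inl enorm_ne_top),
      ← ofReal_norm, ← ENNReal.ofReal_mul (by positivity [ht.1])]
    refine ENNReal.ofReal_le_ofReal ?_
    rw [inv_mul_le_iff₀ ht.1]
    exact hn.le
  calc ENNReal.ofReal (t ^ N)⁻¹ = ENNReal.ofReal (t ^ (s - N)) * ENNReal.ofReal t⁻¹ ^ s := by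
        have h0 := ht.1
        rw [ENNReal.ofReal_rpow_of_pos (by positivity), ← ENNReal.ofReal_mul (by positivity),
          Real.rpow_sub h0, Real.inv_rpow h0.le, Real.rpow_natCast]
        congr 1
        have := (Real.rpow_pos_of_pos h0 s).ne'
        field_simp
    _ ≤ _ := by gcongr

lemma lintegral_Ioo_rpow_lt_top {a : ℝ} (ha : -1 < a) :
    ∫⁻ t in Ioo (0 : ℝ) 1, ENNReal.ofReal (t ^ a) < ⊤ := by
  have h : IntegrableOn (fun t : ℝ => t ^ a) (Ioo 0 1) :=
    (intervalIntegral.integrableOn_Ioo_rpow_iff zero_lt_one).2 ha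
  have := h.2
  refine lt_of_le_of_lt (setLIntegral_mono' measurableSet_Ioo fun t ht => ?_) this
  rw [Real.enorm_of_nonneg (Real.rpow_nonneg ht.1.le _)]

/-! ### Poincaré–Sobolev on star-shaped domains -/

/-- `D` is star-shaped with respect to every point of the ball `ball b ρ ⊆ D`. -/
structure IsStarShapedBall {N : ℕ} (D : Set (E N)) (b : E N) (ρ : ℝ) : Prop where
  pos : 0 < ρ
  ball_subset : Metric.ball b ρ ⊆ D
  segment : ∀ x ∈ D, ∀ y ∈ Metric.ball b ρ, ∀ t ∈ Ioo (0 : ℝ) 1, x + t • (y - x) ∈ D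

/-- The Poincaré–Sobolev inequality on a domain that is star-shaped with respect to a ball, for
subcritical exponents. -/
lemma IsStarShapedBall.poincare_sobolev {N : ℕ} (hN : 3 ≤ N) {D : Set (E N)} {b : E N} {ρ : ℝ}
    (hD : IsStarShapedBall D b ρ) (hDo : IsOpen D) (hDb : Bornology.IsBounded D) {p : ℝ}
    (hp : 2 ≤ p) (hpN : 1 / 2 - 1 / (N : ℝ) < 1 / p) :
    ∃ C : ℝ≥0, ∀ φ : E N → ℝ, ContDiff ℝ 1 φ →
      eLpNorm (fun x => φ x - ⨍ y in Metric.ball b ρ, φ y) (ENNReal.ofReal p)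
        (volume.restrict D) ≤ C * eLpNorm (fderiv ℝ φ) 2 (volume.restrict D) := by
  obtain ⟨d, hd⟩ := hDb.subset_ball_lt 0 0
  obtain ⟨hd0, hd⟩ := hd
  have hp0 : 0 < p := by linarith
  have hN0 : (0 : ℝ) < N := by positivity
  obtain ⟨r, hr⟩ : ∃ r : ℝ, 1 / r = 1 / 2 + 1 / p := ⟨1 / (1 / 2 + 1 / p), by rw [one_div_one_div]⟩
  have hrpos : 0 < r := by
    have : 0 < 1 / r := by rw [hr]; positivity
    exact one_div_pos.1 this
  -- Subcriticality of `p` leaves room for `s` with `N - 1 < s < N/r`: the lower bound makes `∫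
  -- t^(s-N)` finite on `(0,1)`, the upper one puts the kernel in `Lʳ`.
  have hNr : (N : ℝ) - 1 < N * (1 / r) := by
    rw [hr]
    have : (N : ℝ) * (1 / 2 - 1 / N) < N * (1 / p) := mul_lt_mul_of_pos_left hpN hN0
    have e : (N : ℝ) * (1 / N) = 1 := by field_simp
    nlinarith
  obtain ⟨s, hs1, hs2⟩ := exists_between hNr
  have hN3 : (3 : ℝ) ≤ N := by exact_mod_cast hN
  have hs0 : 0 < s := by linarith
  have hsr : s * r < N := by
    have := mul_lt_mul_of_pos_right hs2 hrpos
    rwa [mul_assoc, one_div_mul_cancel hrpos.ne', mul_one] at this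
  -- `D` lies in the ball of radius `d` about `0`, so differences of its points have norm below `2 *
  -- d` and the truncation of the kernel loses nothing.
  set κ := ∫⁻ z : E N, rieszKernel (2 * d) s z ^ r with hκ
  have hκt : κ < ⊤ := lintegral_rieszKernel_rpow_lt_top (by omega) hrpos hsr
  set τ := ∫⁻ t in Ioo (0 : ℝ) 1, ENNReal.ofReal (t ^ (s - N)) with hτ
  have hτt : τ < ⊤ := lintegral_Ioo_rpow_lt_top (by linarith)
  set B := Metric.ball b ρ with hB
  have hBpos : 0 < volume B := Metric.measure_ball_pos _ _ hD.pos
  have hBtop : volume B < ⊤ := measure_ball_lt_top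
  set c : ℝ≥0∞ := (volume B)⁻¹ * (ENNReal.ofReal (2 * d) * τ) with hc
  have hct : c ≠ ⊤ := ENNReal.mul_ne_top (ENNReal.inv_ne_top.2 hBpos.ne')
    (ENNReal.mul_ne_top ENNReal.ofReal_ne_top hτt.ne)
  set C : ℝ≥0∞ := c * (κ ^ (p / 2 + 1)) ^ (1 / p) with hC
  have hCt : C ≠ ⊤ := ENNReal.mul_ne_top hct (ENNReal.rpow_ne_top_of_nonneg (by positivity)
    (ENNReal.rpow_ne_top_of_nonneg (by positivity) hκt.ne))
  refine ⟨C.toNNReal, fun φ hφ => ?_⟩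
  rw [ENNReal.coe_toNNReal hCt]
  clear_value c
  have hφc : Continuous φ := hφ.continuous
  have hφ' : Continuous (fderiv ℝ φ) := hφ.continuous_fderiv (by norm_num)
  -- Extension by zero turns the bound into a convolution on the whole space; star-shapedness keeps
  -- the segments used below inside `D`.
  set f : E N → ℝ≥0∞ := D.indicator fun y => ‖fderiv ℝ φ y‖ₑ with hf
  have hfm : Measurable f := (hφ'.enorm.measurable).indicator hDo.measurableSet
  have hpt : ∀ x ∈ D, ‖φ x - ⨍ y in B, φ y‖ₑ ≤
      c * ∫⁻ y, f y * rieszKernel (2 * d) s (y - x) := by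
    intro x hx
    have hint : IntegrableOn φ B := 
      (hφc.continuousOn.integrableOn_compact (isCompact_closedBall b ρ)).mono_set
        Metric.ball_subset_closedBall
    have h1 : φ x - ⨍ y in B, φ y = (volume.real B)⁻¹ • ∫ y in B, (φ x - φ y) := by
      rw [integral_sub (integrable_const_iff.2 (Or.inr ⟨by simpa using hBtop⟩)) hint,
        setIntegral_const, setAverage_eq,
        smul_sub, smul_smul, inv_mul_cancel₀, one_smul]
      exact (ENNReal.toReal_pos hBpos.ne' hBtop.ne).ne'
    rw [h1, enorm_smul, hc, mul_assoc]
    have h2 : ‖(volume.real B)⁻¹‖ₑ = (volume B)⁻¹ := by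
      rw [Real.enorm_of_nonneg (by positivity), measureReal_def,
        ENNReal.ofReal_inv_of_pos (ENNReal.toReal_pos hBpos.ne' hBtop.ne),
        ENNReal.ofReal_toReal hBtop.ne]
    rw [h2]
    refine mul_le_mul_right ?_ _
    refine (enorm_integral_le_lintegral_enorm _).trans ?_
    have hdist : ∀ y ∈ B, ‖y - x‖ < 2 * d := by
      intro y hy
      have h3 := mem_ball_zero_iff.1 (hd (hD.ball_subset hy))
      have h4 := mem_ball_zero_iff.1 (hd hx)
      calc ‖y - x‖ ≤ ‖y‖ + ‖x‖ := norm_sub_le _ _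
        _ < 2 * d := by linarith
    calc ∫⁻ y in B, ‖φ x - φ y‖ₑ
        ≤ ∫⁻ y in B, ENNReal.ofReal (2 * d) * ∫⁻ t in Ioo (0 : ℝ) 1, f (x + t • (y - x)) := by
          refine setLIntegral_mono' measurableSet_ball fun y hy => ?_
          have h5 := enorm_sub_le_lintegral_fderiv hφ x (y - x) zero_le_one
          rw [one_smul, add_sub_cancel, ← enorm_neg, neg_sub] at h5
          refine h5.trans (mul_le_mul' ?_ ?_)
          · rw [← ofReal_norm]
            exact ENNReal.ofReal_le_ofReal (hdist y hy).le
          · refine setLIntegral_mono' measurableSet_Ioo fun t ht => ?_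
            rw [hf, indicator_of_mem (hD.segment x hx y hy t ht)]
      _ = ENNReal.ofReal (2 * d) * ∫⁻ y in B, ∫⁻ t in Ioo (0 : ℝ) 1, f (x + t • (y - x)) :=
          lintegral_const_mul' _ _ ENNReal.ofReal_ne_top
      _ ≤ ENNReal.ofReal (2 * d) * ∫⁻ y in Metric.ball x (2 * d),
            ∫⁻ t in Ioo (0 : ℝ) 1, f (x + t • (y - x)) := by
          refine mul_le_mul_right (lintegral_mono_set fun y hy => ?_) _
          rw [Metric.mem_ball, dist_eq_norm]
          exact hdist y hy
      _ ≤ ENNReal.ofReal (2 * d) * (τ * ∫⁻ y, f y * rieszKernel (2 * d) s (y - x)) :=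
          mul_le_mul_right (lintegral_lintegral_homothety_le hfm x hs0) _
      _ = _ := by rw [mul_assoc]
  rw [eLpNorm_eq_lintegral_rpow_enorm_toReal (by simpa using hp0) ENNReal.ofReal_ne_top,
    eLpNorm_eq_lintegral_rpow_enorm_toReal (by norm_num) (by norm_num), ENNReal.toReal_ofReal hp0.le]
  have hstep : ∫⁻ x in D, ‖φ x - ⨍ y in B, φ y‖ₑ ^ p ≤
      c ^ p * ((∫⁻ y, f y ^ (2 : ℝ)) ^ (p / 2) * κ ^ (p / 2 + 1)) := by
    calc ∫⁻ x in D, ‖φ x - ⨍ y in B, φ y‖ₑ ^ p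
        ≤ ∫⁻ x in D, c ^ p * (∫⁻ y, f y * rieszKernel (2 * d) s (y - x)) ^ p := by
          refine setLIntegral_mono' hDo.measurableSet fun x hx => ?_
          rw [← ENNReal.mul_rpow_of_nonneg _ _ hp0.le]
          exact ENNReal.rpow_le_rpow (hpt x hx) hp0.le
      _ ≤ ∫⁻ x, c ^ p * (∫⁻ y, f y * rieszKernel (2 * d) s (y - x)) ^ p :=
          setLIntegral_le_lintegral _ _
      _ = c ^ p * ∫⁻ x, (∫⁻ y, f y * rieszKernel (2 * d) s (y - x)) ^ p :=
          lintegral_const_mul' _ _ (ENNReal.rpow_ne_top_of_nonneg hp0.le hct)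
      _ ≤ _ := mul_le_mul_right
          (lintegral_lconvolution_rpow_le hfm (measurable_rieszKernel _ _) hp hr) _
  have hf2 : ∫⁻ y, f y ^ (2 : ℝ) = ∫⁻ y in D, ‖fderiv ℝ φ y‖ₑ ^ (2 : ℝ≥0∞).toReal := by
    rw [← lintegral_indicator hDo.measurableSet]
    refine lintegral_congr fun y => ?_
    by_cases hy : y ∈ D <;> simp [hf, hy]
  refine (ENNReal.rpow_le_rpow hstep (by positivity)).trans (le_of_eq ?_)
  rw [ENNReal.mul_rpow_of_nonneg _ _ (by positivity), ENNReal.mul_rpow_of_nonneg _ _ (by positivity),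
    ← ENNReal.rpow_mul, ← ENNReal.rpow_mul, mul_one_div_cancel hp0.ne', ENNReal.rpow_one, ← hf2, hC,
    show p / 2 * (1 / p) = 1 / (2 : ℝ≥0∞).toReal by simp; field_simp]
  ring

/-! ### Lipschitz graphs: surface measure and traces -/

/-- The point at height `t` above the graph of `γ`, in the rectangular coordinates `A`. -/
def aboveGraph {N : ℕ} (A : E N ≃ₗᵢ[ℝ] WithLp 2 (E (N - 1) × ℝ)) (γ : E (N - 1) → ℝ)
    (w : E (N - 1) × ℝ) : E N :=
  A.symm (WithLp.toLp 2 (w.1, γ w.1 + w.2))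

section AboveGraph

variable {N : ℕ} (A : E N ≃ₗᵢ[ℝ] WithLp 2 (E (N - 1) × ℝ)) {γ : E (N - 1) → ℝ}

lemma norm_le_norm_fst_add_norm_snd (y : E N) : ‖y‖ ≤ ‖(A y).fst‖ + |(A y).snd| := by
  have h : A y = WithLp.toLp 2 ((A y).fst, (0 : ℝ)) + WithLp.toLp 2 ((0 : E (N - 1)), (A y).snd) := by
    apply (WithLp.ofLp_injective 2)
    ext <;> simp
  calc ‖y‖ = ‖A y‖ := (A.norm_map y).symm
    _ ≤ ‖WithLp.toLp 2 ((A y).fst, (0 : ℝ))‖ + ‖WithLp.toLp 2 ((0 : E (N - 1)), (A y).snd)‖ := by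
        conv_lhs => rw [h]
        exact norm_add_le _ _
    _ = _ := by rw [WithLp.norm_toLp_fst, WithLp.norm_toLp_snd, Real.norm_eq_abs]

lemma aboveGraph_eq_add_smul (x : E (N - 1)) (t : ℝ) :
    aboveGraph A γ (x, t) =
      aboveGraph A γ (x, 0) + t • A.symm (WithLp.toLp 2 ((0 : E (N - 1)), (1 : ℝ))) := by
  rw [aboveGraph, aboveGraph, ← map_smul, ← map_add]
  congr 1
  apply (WithLp.ofLp_injective 2)
  ext <;> simp

lemma continuous_aboveGraph (hγ : Continuous γ) : Continuous (aboveGraph A γ) := by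
  unfold aboveGraph
  refine A.symm.continuous.comp ((WithLp.prod_continuous_toLp 2 _ _).comp ?_)
  fun_prop

/-- The map is a vertical shear followed by an isometry, and a shear translates each vertical line.
Thus continuity of `γ` suffices and no Jacobian appears. -/
lemma measurePreserving_aboveGraph (hγ : Continuous γ) :
    MeasurePreserving (aboveGraph A γ) (volume : Measure (E (N - 1) × ℝ)) volume := by
  have h1 : MeasurePreserving (fun w : E (N - 1) × ℝ => (w.1, γ w.1 + w.2)) volume volume := by
    refine MeasurePreserving.skew_product (g := fun x t => γ x + t)
      (MeasurePreserving.id (volume : Measure (E (N - 1)))) ?_ ?_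
    · exact ((hγ.comp continuous_fst).add continuous_snd).measurable
    · exact Eventually.of_forall fun x => (measurePreserving_add_left volume (γ x)).map_eq
  exact (A.symm.measurePreserving.comp (WithLp.volume_preserving_toLp (E (N - 1)) ℝ)).comp h1

lemma lipschitzWith_graph {L : ℝ≥0} (hγ : LipschitzWith L γ) :
    LipschitzWith (1 + L) fun x => aboveGraph A γ (x, 0) := by
  refine LipschitzWith.of_dist_le_mul fun x y => ?_
  rw [dist_eq_norm]
  refine (norm_le_norm_fst_add_norm_snd A _).trans ?_
  have h := hγ.dist_le_mul x y
  rw [Real.dist_eq] at h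
  simp only [aboveGraph, map_sub, LinearIsometryEquiv.apply_symm_apply, WithLp.sub_fst,
    WithLp.sub_snd, add_zero]
  rw [← dist_eq_norm]
  push_cast
  change dist x y + |γ x - γ y| ≤ _
  linarith

/-- The Hausdorff measure on a Lipschitz graph is controlled by Lebesgue measure on the base. -/
lemma exists_hausdorffMeasure_graph_le (hN : 1 ≤ N) {L : ℝ≥0} (hγ : LipschitzWith L γ) :
    ∃ C : ℝ≥0, ∀ S : Set (E (N - 1)),
      Measure.hausdorffMeasure ((N : ℝ) - 1) ((fun x => aboveGraph A γ (x, 0)) '' S) ≤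
        C * volume S := by
  have hd : (N : ℝ) - 1 = ((N - 1 : ℕ) : ℝ) := by push_cast [hN]; ring
  rw [hd]
  set ν : Measure (E (N - 1)) := Measure.hausdorffMeasure ((N - 1 : ℕ) : ℝ) with hν
  -- Hausdorff measure of top dimension on the base is translation invariant, hence a finite
  -- multiple of Lebesgue measure; the value of the factor is irrelevant.
  have hνv : ν = ν.addHaarScalarFactor volume • volume := Measure.isAddLeftInvariant_eq_smul ν volume
  refine ⟨(1 + L) ^ (((N - 1 : ℕ)) : ℝ) * ν.addHaarScalarFactor volume, fun S => ?_⟩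
  refine ((lipschitzWith_graph A hγ).hausdorffMeasure_image_le (Nat.cast_nonneg _) S).trans ?_
  rw [← hν, ENNReal.coe_mul, mul_assoc, ENNReal.coe_rpow_of_nonneg _ (Nat.cast_nonneg _)]
  refine mul_le_mul_right ?_ _
  conv_lhs => rw [hνv]
  rfl

lemma setLIntegral_aboveGraph_le (hγ : Continuous γ) {D : Set (E N)} (hD : MeasurableSet D)
    {B : Set (E (N - 1))} {r : ℝ}
    (hsub : ∀ x ∈ B, ∀ t ∈ Ioo 0 r, aboveGraph A γ (x, t) ∈ D) {f : E N → ℝ≥0∞}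
    (hf : Measurable f) :
    ∫⁻ x in B, ∫⁻ t in Ioo 0 r, f (aboveGraph A γ (x, t)) ≤ ∫⁻ y in D, f y := by
  have hm : Measurable fun w : E (N - 1) × ℝ => f (aboveGraph A γ w) :=
    hf.comp (continuous_aboveGraph A hγ).measurable
  rw [← lintegral_prod (fun w : E (N - 1) × ℝ => f (aboveGraph A γ w)) hm.aemeasurable,
    Measure.prod_restrict, ← Measure.volume_eq_prod,
    ← (measurePreserving_aboveGraph A hγ).setLIntegral_comp_preimage hD hf]
  exact lintegral_mono_set fun w hw => hsub w.1 hw.1 w.2 hw.2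

/-- The trace inequality on a Lipschitz graph. -/
lemma setLIntegral_graph_le (hγ : Continuous γ) {D : Set (E N)} (hD : MeasurableSet D)
    {B : Set (E (N - 1))} {r : ℝ} (hr : 0 < r)
    (hsub : ∀ x ∈ B, ∀ t ∈ Ioo 0 r, aboveGraph A γ (x, t) ∈ D) {φ : E N → ℝ}
    (hφ : ContDiff ℝ 1 φ) (c : ℝ) :
    ∫⁻ x in B, ‖φ (aboveGraph A γ (x, 0)) - c‖ₑ ≤
      (ENNReal.ofReal r)⁻¹ * (∫⁻ y in D, ‖φ y - c‖ₑ) + ∫⁻ y in D, ‖fderiv ℝ φ y‖ₑ := by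
  have hφ' : Continuous (fderiv ℝ φ) := hφ.continuous_fderiv (by norm_num)
  have hr0 : ENNReal.ofReal r ≠ 0 := by simpa using hr
  have hG := continuous_aboveGraph A hγ
  set f : E N → ℝ≥0∞ := fun y => ‖fderiv ℝ φ y‖ₑ with hf
  have hfm : Measurable f := hφ'.enorm.measurable
  set g : E N → ℝ≥0∞ := fun y => ‖φ y - c‖ₑ with hg
  have hgm : Measurable g := (hφ.continuous.sub continuous_const).enorm.measurable
  set I : E (N - 1) → ℝ≥0∞ := fun x => ∫⁻ s in Ioo 0 r, f (aboveGraph A γ (x, s)) with hI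
  set J : E (N - 1) → ℝ≥0∞ := fun x => ∫⁻ s in Ioo 0 r, g (aboveGraph A γ (x, s)) with hJ
  have hJm : Measurable J := (hgm.comp hG.measurable).lintegral_prod_right'
  have hpt : ∀ x, ‖φ (aboveGraph A γ (x, 0)) - c‖ₑ ≤ (ENNReal.ofReal r)⁻¹ * J x + I x := by
    intro x
    -- The boundary value is compared with the value at height `t` by integrating the derivative
    -- vertically; averaging over `t ∈ (0, r)` then produces the factor `1/r`.
    have h1 : ∀ t ∈ Ioo 0 r, ‖φ (aboveGraph A γ (x, 0)) - c‖ₑ ≤ g (aboveGraph A γ (x, t)) + I x := by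
      intro t ht
      have h2 := enorm_sub_le_lintegral_fderiv hφ (aboveGraph A γ (x, 0))
        (A.symm (WithLp.toLp 2 ((0 : E (N - 1)), (1 : ℝ)))) ht.1.le
      simp only [← aboveGraph_eq_add_smul] at h2
      have h3 : ‖A.symm (WithLp.toLp 2 ((0 : E (N - 1)), (1 : ℝ)))‖ₑ = 1 := by
        rw [← ofReal_norm, A.symm.norm_map, WithLp.norm_toLp_snd]
        simp
      rw [h3, one_mul] at h2
      have h4 : φ (aboveGraph A γ (x, 0)) - c = (φ (aboveGraph A γ (x, t)) - c) -
          (φ (aboveGraph A γ (x, t)) - φ (aboveGraph A γ (x, 0))) := by ring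
      rw [h4]
      refine (enorm_sub_le).trans (add_le_add le_rfl (h2.trans ?_))
      exact lintegral_mono_set (Ioo_subset_Ioo_right ht.2.le)
    have h5 : ‖φ (aboveGraph A γ (x, 0)) - c‖ₑ * ENNReal.ofReal r ≤ J x + I x * ENNReal.ofReal r := by
      calc ‖φ (aboveGraph A γ (x, 0)) - c‖ₑ * ENNReal.ofReal r
          = ∫⁻ _ in Ioo 0 r, ‖φ (aboveGraph A γ (x, 0)) - c‖ₑ := by simp
        _ ≤ ∫⁻ t in Ioo 0 r, (g (aboveGraph A γ (x, t)) + I x) :=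
            setLIntegral_mono' measurableSet_Ioo h1
        _ = _ := by
            rw [lintegral_add_right _ measurable_const]
            simp [hJ]
    calc ‖φ (aboveGraph A γ (x, 0)) - c‖ₑ
        = (ENNReal.ofReal r)⁻¹ * (‖φ (aboveGraph A γ (x, 0)) - c‖ₑ * ENNReal.ofReal r) := by
          rw [mul_comm ‖_‖ₑ, ← mul_assoc, ENNReal.inv_mul_cancel hr0 ENNReal.ofReal_ne_top, one_mul]
      _ ≤ (ENNReal.ofReal r)⁻¹ * (J x + I x * ENNReal.ofReal r) := mul_le_mul_right h5 _
      _ = _ := by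
          rw [mul_add, mul_comm (I x), ← mul_assoc _ (ENNReal.ofReal r),
            ENNReal.inv_mul_cancel hr0 ENNReal.ofReal_ne_top, one_mul]
  calc ∫⁻ x in B, ‖φ (aboveGraph A γ (x, 0)) - c‖ₑ
      ≤ ∫⁻ x in B, ((ENNReal.ofReal r)⁻¹ * J x + I x) := lintegral_mono hpt
    _ = (ENNReal.ofReal r)⁻¹ * (∫⁻ x in B, J x) + ∫⁻ x in B, I x := by
        rw [lintegral_add_left (hJm.const_mul _), lintegral_const_mul _ hJm]
    _ ≤ _ := add_le_add (mul_le_mul_right (setLIntegral_aboveGraph_le A hγ hD hsub hgm) _)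
        (setLIntegral_aboveGraph_le A hγ hD hsub hfm)

end AboveGraph

/-! ### Local charts of a Lipschitz domain -/

/-- `K ∩ Ω` is star-shaped with respect to the ball `ball b ρ`, and a trace inequality holds on
`K ∩ ∂Ω`. -/
structure IsTraceChart {N : ℕ} (Ω K : Set (E N)) (b : E N) (ρ : ℝ) : Prop where
  isOpen : IsOpen K
  starShaped : IsStarShapedBall (K ∩ Ω) b ρ
  surf_ne_top : surf Ω K ≠ ⊤
  trace : ∃ C : ℝ≥0, ∀ φ : E N → ℝ, ContDiff ℝ 1 φ → ∀ c : ℝ,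
    ∫⁻ x in K, ‖φ x - c‖ₑ ∂(surf Ω) ≤
      C * ((∫⁻ x in K ∩ Ω, ‖φ x - c‖ₑ) + ∫⁻ x in K ∩ Ω, ‖fderiv ℝ φ x‖ₑ)

/-- A ball inside `Ω` does not meet the boundary, so its trace inequality holds with constant `0`.
-/
lemma exists_isTraceChart_of_mem {N : ℕ} {Ω : Set (E N)} (hΩ : IsOpen Ω) {P : E N} (hP : P ∈ Ω) :
    ∃ K b ρ, P ∈ K ∧ IsTraceChart Ω K b ρ := by
  obtain ⟨r, hr, hsub⟩ := Metric.isOpen_iff.1 hΩ P hP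
  have hK : Metric.ball P r ∩ Ω = Metric.ball P r := inter_eq_left.2 hsub
  have h0 : surf Ω (Metric.ball P r) = 0 := by
    rw [surf, Measure.restrict_apply measurableSet_ball]
    have : Metric.ball P r ∩ frontier Ω = ∅ := by
      rw [hΩ.frontier_eq]
      ext x
      simp only [mem_inter_iff, Set.mem_sdiff, mem_empty_iff_false, iff_false]
      exact fun h => h.2.2 (hsub h.1)
    simp [this]
  refine ⟨Metric.ball P r, P, r, Metric.mem_ball_self hr, Metric.isOpen_ball, ?_, by simp [h0], 0,
    fun φ _ c => ?_⟩
  · rw [hK]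
    refine ⟨hr, subset_rfl, fun x hx y hy t ht => ?_⟩
    exact (convex_ball P r).add_smul_sub_mem hx hy ⟨ht.1.le, ht.2.le⟩
  · rw [Measure.restrict_eq_zero.2 h0]
    simp

/-- The chart is a cylinder around `P` in graph coordinates, tall compared with the oscillation of
the graph over its base. A small ball placed high enough inside it sees every point above the graph.
-/
lemma exists_isTraceChart_of_mem_frontier {N : ℕ} (hN : 1 ≤ N) {Ω : Set (E N)} (hΩ : IsOpen Ω)
    (hL : IsLipschitzSet Ω) {P : E N} (hP : P ∈ frontier Ω) :
    ∃ K b ρ, P ∈ K ∧ IsTraceChart Ω K b ρ := by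
  obtain ⟨A, U, γ, L, hU, hPU, hγ, hUΩ⟩ := hL P hP
  have hγc := hγ.continuous
  have hfst : Continuous fun y => (A y).fst := (WithLp.continuous_fst 2 _ _).comp A.continuous
  have hsnd : Continuous fun y => (A y).snd := (WithLp.continuous_snd 2 _ _).comp A.continuous
  have hmem : ∀ y ∈ U, (y ∈ Ω ↔ γ (A y).fst < (A y).snd) := by
    intro y hy
    have := congrArg (y ∈ ·) hUΩ
    simpa [hy] using this
  have hgraph : ∀ y ∈ U, y ∈ frontier Ω → γ (A y).fst = (A y).snd := by
    intro y hyU hy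
    rw [hΩ.frontier_eq] at hy
    refine le_antisymm ?_ (not_lt.1 fun h => hy.2 ((hmem y hyU).2 h))
    have h1 : closure (U ∩ Ω) ⊆ {y | γ (A y).fst ≤ (A y).snd} :=
      closure_minimal (fun y hy => ((hmem y hy.1).1 hy.2).le)
        (isClosed_le (hγc.comp hfst) hsnd)
    exact h1 (hU.inter_closure ⟨hyU, hy.1⟩)
  obtain ⟨ε, hε, hεU⟩ := Metric.isOpen_iff.1 hU P hPU
  set x₀ := (A P).fst with hx₀
  set z₀ := (A P).snd with hz₀
  have hγ₀ : γ x₀ = z₀ := hgraph P hPU hP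
  have hL0 : (0 : ℝ) ≤ L := L.2
  -- Base radius `r` plus half-height `(4L + 2) r` equals `ε`, so the cylinder stays in the ball
  -- where the graph description is valid.
  obtain ⟨r, hr, hrε⟩ : ∃ r : ℝ, 0 < r ∧ (4 * L + 3) * r = ε :=
    ⟨ε / (4 * L + 3), by positivity, by field_simp⟩
  have hLr : 0 ≤ L * r := by positivity
  have hγb : ∀ x ∈ Metric.ball x₀ r, |γ x - z₀| ≤ L * r := by
    intro x hx
    rw [← hγ₀, ← Real.dist_eq]
    exact (hγ.dist_le_mul x x₀).trans (mul_le_mul_of_nonneg_left (le_of_lt hx) hL0)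
  set K : Set (E N) := {y | (A y).fst ∈ Metric.ball x₀ r ∧
    (A y).snd ∈ Metric.ball z₀ ((4 * L + 2) * r)} with hK
  have hKo : IsOpen K := (Metric.isOpen_ball.preimage hfst).inter (Metric.isOpen_ball.preimage hsnd)
  have hKU : K ⊆ U := by
    intro y hy
    refine hεU ?_
    rw [Metric.mem_ball, dist_eq_norm]
    refine lt_of_le_of_lt (norm_le_norm_fst_add_norm_snd A _) ?_
    have h1 : ‖(A y).fst - x₀‖ < r := by rw [← dist_eq_norm]; exact hy.1
    have h2 : |(A y).snd - z₀| < (4 * L + 2) * r := by rw [← Real.dist_eq]; exact hy.2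
    rw [map_sub, WithLp.sub_fst, WithLp.sub_snd]
    linarith
  have hPK : P ∈ K := ⟨Metric.mem_ball_self hr, Metric.mem_ball_self (by positivity)⟩
  have hKΩ : ∀ y ∈ K, (y ∈ Ω ↔ γ (A y).fst < (A y).snd) := fun y hy => hmem y (hKU hy)
  -- Over the base the graph stays below `z₀ + L r`. The ball of radius `r / 2` about `b` lies above
  -- `z₀ + (3L + 1/2) r`, hence more than `2 L r` above the graph, and below the lid `z₀ + (4L + 2)
  -- r`.
  set b : E N := A.symm (WithLp.toLp 2 (x₀, z₀ + (3 * L + 1) * r)) with hb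
  have hbA : (A b).fst = x₀ ∧ (A b).snd = z₀ + (3 * L + 1) * r := by simp [hb]
  have hball : ∀ y ∈ Metric.ball b (r / 2), (A y).fst ∈ Metric.ball x₀ r ∧
      z₀ + (3 * L + 1 / 2) * r < (A y).snd ∧ (A y).snd < z₀ + (3 * L + 3 / 2) * r := by
    intro y hy
    have hy' : ‖A (y - b)‖ < r / 2 := by rw [A.norm_map, ← dist_eq_norm]; exact hy
    have h1 := (WithLp.norm_fst_le _ (A (y - b))).trans_lt hy'
    have h2 := (WithLp.norm_snd_le _ (A (y - b))).trans_lt hy'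
    rw [map_sub, WithLp.sub_fst, hbA.1] at h1
    rw [map_sub, WithLp.sub_snd, hbA.2, Real.norm_eq_abs, abs_lt] at h2
    refine ⟨?_, by linarith [h2.1], by linarith [h2.2]⟩
    rw [Metric.mem_ball, dist_eq_norm]
    linarith
  have hballK : Metric.ball b (r / 2) ⊆ K ∩ Ω := by
    intro y hy
    obtain ⟨h1, h2, h3⟩ := hball y hy
    have hyK : y ∈ K := by
      refine ⟨h1, ?_⟩
      rw [Metric.mem_ball, Real.dist_eq, abs_lt]
      constructor <;> nlinarith
    refine ⟨hyK, (hKΩ y hyK).2 ?_⟩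
    have := (abs_le.1 (hγb _ h1)).2
    nlinarith
  have hKconv : ∀ y ∈ K, ∀ w ∈ K, ∀ t ∈ Ioo (0 : ℝ) 1, y + t • (w - y) ∈ K := by
    intro y hy w hw t ht
    constructor
    · have := (convex_ball x₀ r).add_smul_sub_mem hy.1 hw.1 ⟨ht.1.le, ht.2.le⟩
      simpa using this
    · have := (convex_ball z₀ ((4 * L + 2) * r)).add_smul_sub_mem hy.2 hw.2 ⟨ht.1.le, ht.2.le⟩
      simpa using this
  obtain ⟨C, hC⟩ := exists_hausdorffMeasure_graph_le A hN hγ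
  -- Inside `K` the boundary lies on the graph, so surface integrals over `K` reduce to integrals
  -- over the base.
  have hle : (surf Ω).restrict K ≤ (C : ℝ≥0∞) • Measure.map (fun x => aboveGraph A γ (x, 0))
      (volume.restrict (Metric.ball x₀ r)) := by
    refine Measure.le_iff.2 fun S hS => ?_
    have hgm : Measurable fun x => aboveGraph A γ (x, 0) :=
      (lipschitzWith_graph A hγ).continuous.measurable
    rw [Measure.restrict_apply hS, surf, Measure.restrict_apply (hS.inter hKo.measurableSet),
      Measure.smul_apply, Measure.map_apply hgm hS, Measure.restrict_apply (hgm hS), smul_eq_mul]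
    refine le_trans (measure_mono ?_) (hC _)
    rintro y ⟨⟨hyS, hyK⟩, hyΩ⟩
    have hy : aboveGraph A γ ((A y).fst, 0) = y := by
      rw [aboveGraph]
      simp only [hgraph y (hKU hyK) hyΩ, add_zero]
      rw [LinearIsometryEquiv.symm_apply_eq]
      apply (WithLp.ofLp_injective 2)
      ext <;> simp
    exact ⟨(A y).fst, ⟨by simpa [hy] using hyS, hyK.1⟩, hy⟩
  refine ⟨K, b, r / 2, hPK, hKo, ⟨by positivity, hballK, ?_⟩, ?_, ?_⟩
  · intro y hy w hw t ht
    have hwK := (hballK hw).1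
    have hpK := hKconv y hy.1 w hwK t ht
    refine ⟨hpK, (hKΩ _ hpK).2 ?_⟩
    have hyΩ := (hKΩ y hy.1).1 hy.2
    obtain ⟨h1, h2, h3⟩ := hball w hw
    have hp2 : (A (y + t • (w - y))).snd = (A y).snd + t * ((A w).snd - (A y).snd) := by simp
    have hp1 : (A (y + t • (w - y))).fst = (A y).fst + t • ((A w).fst - (A y).fst) := by simp
    -- If `y` is at least `2 L r` lower than `w`, the segment climbs by at least `2 L r t`, and the
    -- graph by at most that much since the base has diameter at most `2 r`. Otherwise the whole
    -- segment stays above `(A w).snd - 2 L r`, which exceeds the maximal graph height `z₀ + L r`.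
    rcases le_total (A y).snd ((A w).snd - 2 * (L * r)) with hc | hc
    · have h4 := hγ.dist_le_mul (A (y + t • (w - y))).fst (A y).fst
      rw [Real.dist_eq, hp1, dist_eq_norm, add_sub_cancel_left, norm_smul,
        Real.norm_of_nonneg ht.1.le] at h4
      have h5 : ‖(A w).fst - (A y).fst‖ ≤ 2 * r := by
        rw [← dist_eq_norm]
        have ha := dist_triangle_right (A w).fst (A y).fst x₀
        have hb1 : dist (A w).fst x₀ < r := h1
        have hb2 : dist (A y).fst x₀ < r := hy.1.1
        linarith
      have h6 := le_of_abs_le h4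
      have h7 : (L : ℝ) * (t * ‖(A w).fst - (A y).fst‖) ≤ t * (2 * (L * r)) := by
        have := mul_le_mul_of_nonneg_left h5 (mul_nonneg hL0 ht.1.le)
        linarith
      have h8 : t * (2 * (L * r)) ≤ t * ((A w).snd - (A y).snd) :=
        mul_le_mul_of_nonneg_left (by linarith) ht.1.le
      rw [hp2, hp1]
      linarith
    · have h4 := (abs_le.1 (hγb _ hpK.1)).2
      have h5 : (A w).snd - 2 * (L * r) ≤ (A (y + t • (w - y))).snd := by
        rw [hp2]
        have e1 : 0 ≤ (1 - t) * ((A y).snd - ((A w).snd - 2 * (L * r))) :=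
          mul_nonneg (by linarith [ht.2]) (by linarith)
        have e2 : 0 ≤ t * (2 * (L * r)) := mul_nonneg ht.1.le (by linarith)
        linarith
      linarith
  · have h1 := Measure.le_iff.1 hle univ MeasurableSet.univ
    rw [Measure.restrict_apply_univ] at h1
    refine ne_top_of_le_ne_top ?_ h1
    rw [Measure.smul_apply, smul_eq_mul, Measure.map_apply
      (lipschitzWith_graph A hγ).continuous.measurable MeasurableSet.univ]
    refine ENNReal.mul_ne_top ENNReal.coe_ne_top ?_
    simpa using measure_ball_lt_top.ne
  · have hsub : ∀ x ∈ Metric.ball x₀ r, ∀ t ∈ Ioo 0 r, aboveGraph A γ (x, t) ∈ K ∩ Ω := by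
      intro x hx t ht
      have h1 : (A (aboveGraph A γ (x, t))).fst = x := by simp [aboveGraph]
      have h2 : (A (aboveGraph A γ (x, t))).snd = γ x + t := by simp [aboveGraph]
      have h3 := abs_le.1 (hγb x hx)
      have hk : aboveGraph A γ (x, t) ∈ K := by
        refine ⟨by rwa [h1], ?_⟩
        rw [h2, Metric.mem_ball, Real.dist_eq, abs_lt]
        constructor <;> linarith [ht.1, ht.2, h3.1, h3.2]
      refine ⟨hk, (hKΩ _ hk).2 ?_⟩
      rw [h1, h2]
      linarith [ht.1]
    refine ⟨C * (r.toNNReal⁻¹ + 1), fun φ hφ c => ?_⟩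
    have hgm : Measurable fun x => aboveGraph A γ (x, 0) :=
      (lipschitzWith_graph A hγ).continuous.measurable
    have hφm : Measurable fun y => ‖φ y - c‖ₑ :=
      (hφ.continuous.sub continuous_const).enorm.measurable
    refine (lintegral_mono' hle le_rfl).trans ?_
    rw [lintegral_smul_measure, lintegral_map hφm hgm, smul_eq_mul, ENNReal.coe_mul, mul_assoc]
    refine mul_le_mul_right ?_ _
    refine (setLIntegral_graph_le A hγc (hKo.inter hΩ).measurableSet hr hsub
      hφ c).trans ?_
    rw [ENNReal.coe_add, ENNReal.coe_inv (by simpa using hr), ENNReal.coe_one, mul_add]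
    refine add_le_add (mul_le_mul_left le_self_add _) ?_
    exact le_mul_of_one_le_left (zero_le) le_add_self

lemma IsBoundedLipschitzDomain.exists_isTraceChart {N : ℕ} (hN : 1 ≤ N) {Ω : Set (E N)}
    (hΩ : IsBoundedLipschitzDomain Ω) {P : E N} (hP : P ∈ closure Ω) :
    ∃ K b ρ, P ∈ K ∧ IsTraceChart Ω K b ρ := by
  by_cases h : P ∈ Ω
  · exact exists_isTraceChart_of_mem hΩ.isOpen h
  · exact exists_isTraceChart_of_mem_frontier hN hΩ.isOpen hΩ.isLipschitz
      (by rw [hΩ.isOpen.frontier_eq]; exact ⟨hP, h⟩)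

/-! ### Weak gradients and approximation by smooth functions -/

lemma isFiniteMeasure_restrict_of_isBounded {N : ℕ} {Ω : Set (E N)} (hΩ : Bornology.IsBounded Ω) :
    IsFiniteMeasure (volume.restrict Ω) :=
  ⟨by simpa using hΩ.measure_lt_top⟩

lemma locallyIntegrableOn_of_memLp {N : ℕ} {F : Type*} [NormedAddCommGroup F] {Ω : Set (E N)}
    (hΩ : Bornology.IsBounded Ω) {p : ℝ≥0∞} (hp : 1 ≤ p) {f : E N → F}
    (hf : MemLp f p (volume.restrict Ω)) : LocallyIntegrableOn f Ω := by
  have := isFiniteMeasure_restrict_of_isBounded hΩ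
  exact IntegrableOn.locallyIntegrableOn (hf.integrable hp)

lemma gradient_apply {N : ℕ} (φ : E N → ℝ) (x : E N) (i : Fin N) :
    gradient φ x i = fderiv ℝ φ x (EuclideanSpace.single i 1) := by
  rw [← inner_gradient_left, EuclideanSpace.inner_single_right]
  simp

lemma enorm_gradient {N : ℕ} (φ : E N → ℝ) (x : E N) : ‖gradient φ x‖ₑ = ‖fderiv ℝ φ x‖ₑ := by
  rw [← ofReal_norm, ← ofReal_norm, gradient, LinearIsometryEquiv.norm_map]

lemma continuous_gradient {N : ℕ} {φ : E N → ℝ} (hφ : ContDiff ℝ 1 φ) : Continuous (gradient φ) :=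
  (InnerProductSpace.toDual ℝ (E N)).symm.continuous.comp (hφ.continuous_fderiv (by norm_num))

/-- The test function is supported in `Ω`, so the integration by parts takes place on the whole
space and the boundary of `Ω` plays no role. -/
lemma hasWeakGradient_gradient {N : ℕ} (Ω : Set (E N)) {φ : E N → ℝ} (hφ : ContDiff ℝ 1 φ) :
    HasWeakGradient Ω φ (gradient φ) where
  locInt := hφ.continuous.locallyIntegrable.locallyIntegrableOn Ω
  locIntGrad := (continuous_gradient hφ).locallyIntegrable.locallyIntegrableOn Ω
  eq ψ h1 h2 h3 i := by
    have hz : ∀ x, x ∉ Ω → ψ x = 0 := fun x hx => image_eq_zero_of_notMem_tsupport fun h => hx (h3 h)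
    have hz' : ∀ x, x ∉ Ω → fderiv ℝ ψ x (EuclideanSpace.single i 1) = 0 := fun x hx =>
      image_eq_zero_of_notMem_tsupport (f := fun x => fderiv ℝ ψ x (EuclideanSpace.single i 1))
        fun h => hx (h3 (tsupport_fderiv_apply_subset ℝ (EuclideanSpace.single i 1) h))
    rw [setIntegral_eq_integral_of_forall_compl_eq_zero (fun x hx => by rw [hz' x hx, mul_zero]),
      setIntegral_eq_integral_of_forall_compl_eq_zero (fun x hx => by rw [hz x hx, mul_zero])]
    simp only [gradient_apply]
    have hψd : Continuous fun x => fderiv ℝ ψ x (EuclideanSpace.single i 1) :=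
      (h1.continuous_fderiv (by simp)).clm_apply continuous_const
    have hφd : Continuous fun x => fderiv ℝ φ x (EuclideanSpace.single i 1) :=
      (hφ.continuous_fderiv (by norm_num)).clm_apply continuous_const
    refine integral_mul_fderiv_eq_neg_fderiv_mul_of_integrable ?_ ?_ ?_ ?_ ?_
    · exact (hφd.mul h1.continuous).integrable_of_hasCompactSupport h2.mul_left
    · exact (hφ.continuous.mul hψd).integrable_of_hasCompactSupport
        (h2.fderiv_apply (𝕜 := ℝ) _).mul_left
    · exact (hφ.continuous.mul h1.continuous).integrable_of_hasCompactSupport h2.mul_left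
    · exact fun x _ => (hφ.differentiable (by norm_num)) x
    · exact fun x _ => (h1.differentiable (by simp)) x

lemma HasWeakGradient.sub {N : ℕ} {Ω : Set (E N)} {u v : E N → ℝ} {G H : E N → E N}
    (hu : HasWeakGradient Ω u G) (hv : HasWeakGradient Ω v H) :
    HasWeakGradient Ω (fun x => u x - v x) (fun x => G x - H x) := by
  simpa [sub_eq_add_neg] using hu.add (hv.const_smul (-1))

/-- Uniqueness of the weak gradient. -/
lemma HasWeakGradient.ae_eq {N : ℕ} {Ω : Set (E N)} (hΩ : IsOpen Ω) {u : E N → ℝ}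
    {G H : E N → E N} (hG : HasWeakGradient Ω u G) (hH : HasWeakGradient Ω u H) :
    G =ᵐ[volume.restrict Ω] H := by
  have h : ∀ i, ∀ᵐ x, x ∈ Ω → G x i - H x i = 0 := by
    intro i
    have hGi := locallyIntegrableOn_coord hG.locIntGrad i
    have hHi := locallyIntegrableOn_coord hH.locIntGrad i
    refine hΩ.ae_eq_zero_of_integral_contDiff_smul_eq_zero (hGi.sub hHi) fun ψ h1 h2 h3 => ?_
    have hz : ∀ x, x ∉ Ω → ψ x = 0 := fun x hx => image_eq_zero_of_notMem_tsupport fun h => hx (h3 h)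
    rw [← setIntegral_eq_integral_of_forall_compl_eq_zero (s := Ω)
      (fun x hx => by rw [hz x hx, zero_smul])]
    simp only [smul_eq_mul, mul_comm (ψ _), sub_mul]
    rw [integral_sub (integrable_right hG.locIntGrad h1 h2 h3 i)
      (integrable_right hH.locIntGrad h1 h2 h3 i)]
    have e1 := hG.eq ψ h1 h2 h3 i
    have e2 := hH.eq ψ h1 h2 h3 i
    linarith
  rw [Filter.EventuallyEq, ae_restrict_iff' hΩ.measurableSet]
  filter_upwards [ae_all_iff.2 h] with x hx hxΩ
  ext i
  exact sub_eq_zero.1 (hx i hxΩ)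

lemma HasWeakGradient.w1Norm_eq {N : ℕ} {Ω : Set (E N)} (hΩ : IsOpen Ω) {u : E N → ℝ}
    {G : E N → E N} (hG : HasWeakGradient Ω u G) (p : ℝ≥0∞) :
    w1Norm Ω p u =
      eLpNorm u p (volume.restrict Ω) + ∑ i, eLpNorm (fun x => G x i) p (volume.restrict Ω) := by
  refine le_antisymm (iInf₂_le _ hG) (le_iInf₂ fun H hH => ?_)
  refine add_le_add le_rfl (Finset.sum_le_sum fun i _ => le_of_eq (eLpNorm_congr_ae ?_))
  filter_upwards [hG.ae_eq hΩ hH] with x hx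
  rw [hx]

lemma eLpNorm_le_sum_coord {N : ℕ} {μ : Measure (E N)} {G : E N → E N}
    (hG : AEStronglyMeasurable G μ) {p : ℝ≥0∞} (hp : 1 ≤ p) :
    eLpNorm G p μ ≤ ∑ i, eLpNorm (fun x => G x i) p μ := by
  have hGi : ∀ i, AEStronglyMeasurable (fun x => G x i) μ := fun i =>
    (EuclideanSpace.proj i : E N →L[ℝ] ℝ).continuous.comp_aestronglyMeasurable hG
  have h1 : eLpNorm G p μ ≤ eLpNorm (∑ i, fun x => ‖G x i‖) p μ := by
    refine eLpNorm_mono_real fun x => ?_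
    have h2 : G x = ∑ i, EuclideanSpace.single i (G x i) := by
      ext j
      simp [Finset.sum_apply]
    rw [Finset.sum_apply]
    conv_lhs => rw [h2]
    refine (norm_sum_le _ _).trans (le_of_eq ?_)
    simp
  refine (h1.trans (eLpNorm_sum_le (fun i _ => (hGi i).norm) hp)).trans (le_of_eq ?_)
  exact Finset.sum_congr rfl fun i _ => eLpNorm_norm _

lemma eLpNorm_coord_le {N : ℕ} {μ : Measure (E N)} (G : E N → E N) (p : ℝ≥0∞) (i : Fin N) :
    eLpNorm (fun x => G x i) p μ ≤ eLpNorm G p μ :=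
  eLpNorm_mono fun x => PiLp.norm_apply_le (G x) i

lemma HasWeakGradient.w1Norm_le {N : ℕ} {Ω : Set (E N)} {u : E N → ℝ}
    {G : E N → E N} (hG : HasWeakGradient Ω u G) (p : ℝ≥0∞) :
    w1Norm Ω p u ≤
      eLpNorm u p (volume.restrict Ω) + N * eLpNorm G p (volume.restrict Ω) := by
  refine (iInf₂_le _ hG).trans (add_le_add le_rfl ?_)
  refine (Finset.sum_le_sum fun i _ => eLpNorm_coord_le G p i).trans (le_of_eq ?_)
  simp

lemma MemW1.memLp_of_hasWeakGradient {N : ℕ} {Ω : Set (E N)} (hΩ : IsOpen Ω) {p : ℝ≥0∞}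
    {u : E N → ℝ} {G : E N → E N} (hu : MemW1 Ω p u) (hG : HasWeakGradient Ω u G) :
    MemLp G p (volume.restrict Ω) := by
  obtain ⟨_, H, hH, hHp⟩ := hu
  exact (memLp_congr_ae (hG.ae_eq hΩ hH)).2 hHp

/-- `C¹` functions approximate `u` in `H¹(Ω)` and its trace `g` in `L²(∂Ω)`. -/
structure IsTraceApprox {N : ℕ} (Ω : Set (E N)) (φ : ℕ → E N → ℝ) (u : E N → ℝ) (G : E N → E N)
    (g : E N → ℝ) : Prop where
  contDiff : ∀ k, ContDiff ℝ 1 (φ k)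
  tendsto : Tendsto (fun k => eLpNorm (fun x => φ k x - u x) 2 (volume.restrict Ω)) atTop (𝓝 0)
  tendsto_gradient : Tendsto (fun k => eLpNorm (fun x => gradient (φ k) x - G x) 2
    (volume.restrict Ω)) atTop (𝓝 0)
  tendsto_trace : Tendsto (fun k => eLpNorm (fun x => φ k x - g x) 2 (surf Ω)) atTop (𝓝 0)

lemma IsTraceApprox.comp {N : ℕ} {Ω : Set (E N)} {φ : ℕ → E N → ℝ} {u : E N → ℝ} {G : E N → E N}
    {g : E N → ℝ} (h : IsTraceApprox Ω φ u G g) {n : ℕ → ℕ} (hn : StrictMono n) :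
    IsTraceApprox Ω (fun k => φ (n k)) u G g :=
  ⟨fun k => h.contDiff (n k), h.tendsto.comp hn.tendsto_atTop,
    h.tendsto_gradient.comp hn.tendsto_atTop, h.tendsto_trace.comp hn.tendsto_atTop⟩

/-- Almost everywhere convergence is needed for dominated convergence in the chain rule and for
Fatou's lemma in the Poincaré–Sobolev inequality. -/
lemma IsTraceApprox.exists_ae_tendsto {N : ℕ} {Ω : Set (E N)} {φ : ℕ → E N → ℝ} {u : E N → ℝ}
    {G : E N → E N} {g : E N → ℝ} (h : IsTraceApprox Ω φ u G g)
    (hu : AEStronglyMeasurable u (volume.restrict Ω)) :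
    ∃ n : ℕ → ℕ, StrictMono n ∧ IsTraceApprox Ω (fun k => φ (n k)) u G g ∧
      ∀ᵐ x ∂(volume.restrict Ω), Tendsto (fun k => φ (n k) x) atTop (𝓝 (u x)) := by
  have h1 : TendstoInMeasure (volume.restrict Ω) φ atTop u :=
    tendstoInMeasure_of_tendsto_eLpNorm (p := 2) (by norm_num)
      (fun k => (h.contDiff k).continuous.aestronglyMeasurable) hu h.tendsto
  obtain ⟨n, hn, hae⟩ := h1.exists_seq_tendsto_ae
  exact ⟨n, hn, h.comp hn, hae⟩

/-- `w1Norm` is an infimum over weak gradients; uniqueness on the open set `Ω` lets the convergence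
be read off at the prescribed gradient `G`. -/
lemma HasTrace.exists_isTraceApprox {N : ℕ} {Ω : Set (E N)} (hΩ : IsOpen Ω) {u : E N → ℝ}
    {G : E N → E N} {g : Lp ℝ 2 (surf Ω)} (hu : HasTrace Ω u g) (hG : HasWeakGradient Ω u G) :
    ∃ φ, IsTraceApprox Ω φ u G g := by
  obtain ⟨_, φ, hφ, h1, h2⟩ := hu
  have hw : ∀ k, HasWeakGradient Ω (fun x => φ k x - u x) (fun x => gradient (φ k) x - G x) :=
    fun k => (hasWeakGradient_gradient Ω (hφ k)).sub hG
  simp only [fun k => (hw k).w1Norm_eq hΩ 2] at h1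
  refine ⟨φ, hφ, ?_, ?_, h2⟩
  · exact tendsto_of_tendsto_of_tendsto_of_le_of_le tendsto_const_nhds h1 (fun _ => zero_le)
      fun k => le_self_add
  · refine tendsto_of_tendsto_of_tendsto_of_le_of_le tendsto_const_nhds h1 (fun _ => zero_le)
      fun k => le_trans ?_ le_add_self
    exact eLpNorm_le_sum_coord (hw k).locIntGrad.aestronglyMeasurable (by norm_num)

lemma tendsto_integral_mul_of_tendsto_eLpNorm_two {α : Type*} [MeasurableSpace α] {μ : Measure α}
    {f : ℕ → α → ℝ} {g η : α → ℝ} (hf : ∀ k, AEStronglyMeasurable (f k) μ) (hg : MemLp g 2 μ)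
    (hη : MemLp η 2 μ) (h : Tendsto (fun k => eLpNorm (fun x => f k x - g x) 2 μ) atTop (𝓝 0)) :
    Tendsto (fun k => ∫ x, f k x * η x ∂μ) atTop (𝓝 (∫ x, g x * η x ∂μ)) := by
  have hgη : Integrable (fun x => g x * η x) μ := hg.integrable_mul hη
  refine tendsto_integral_of_L1' _ hgη.aestronglyMeasurable ?_ ?_
  · have hfin : ∀ᶠ k in atTop, eLpNorm (fun x => f k x - g x) 2 μ < ⊤ :=
      h.eventually_lt_const (by simp)
    filter_upwards [hfin] with k hk
    have h1 : MemLp (fun x => f k x - g x) 2 μ := ⟨(hf k).sub hg.aestronglyMeasurable, hk⟩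
    have h2 := (h1.integrable_mul hη).add hgη
    refine h2.congr (Eventually.of_forall fun x => ?_)
    simp only [Pi.add_apply, Pi.mul_apply]
    ring
  · have h0 : Tendsto (fun k => eLpNorm (fun x => f k x - g x) 2 μ * eLpNorm η 2 μ) atTop (𝓝 0) := by
      simpa using ENNReal.Tendsto.mul_const h (Or.inr hη.eLpNorm_ne_top)
    refine tendsto_of_tendsto_of_tendsto_of_le_of_le tendsto_const_nhds h0 (fun _ => zero_le)
      fun k => ?_
    have h3 : ((fun x => f k x * η x) - fun x => g x * η x) =
        (fun x => f k x - g x) • η := by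
      ext x
      simp [sub_mul]
    simp only [h3]
    exact eLpNorm_smul_le_mul_eLpNorm hη.aestronglyMeasurable
      ((hf k).sub hg.aestronglyMeasurable)

/-- The weak gradient is a closed operator in `L²`. -/
lemma hasWeakGradient_of_tendsto {N : ℕ} {Ω : Set (E N)} (hΩ : Bornology.IsBounded Ω)
    {v : ℕ → E N → ℝ} {H : ℕ → E N → E N} {u : E N → ℝ} {G : E N → E N}
    (hv : ∀ k, HasWeakGradient Ω (v k) (H k)) (hu : MemLp u 2 (volume.restrict Ω))
    (hG : MemLp G 2 (volume.restrict Ω))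
    (h1 : Tendsto (fun k => eLpNorm (fun x => v k x - u x) 2 (volume.restrict Ω)) atTop (𝓝 0))
    (h2 : Tendsto (fun k => eLpNorm (fun x => H k x - G x) 2 (volume.restrict Ω)) atTop (𝓝 0)) :
    HasWeakGradient Ω u G where
  locInt := locallyIntegrableOn_of_memLp hΩ (by norm_num) hu
  locIntGrad := locallyIntegrableOn_of_memLp hΩ (by norm_num) hG
  eq ψ hψ hψc hψs i := by
    have hGi : MemLp (fun x => G x i) 2 (volume.restrict Ω) :=
      (EuclideanSpace.proj i : E N →L[ℝ] ℝ).comp_memLp' hG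
    have hψm : MemLp ψ 2 (volume.restrict Ω) :=
      (hψ.continuous.memLp_of_hasCompactSupport hψc).restrict _
    have hψd : MemLp (fun x => fderiv ℝ ψ x (EuclideanSpace.single i 1)) 2 (volume.restrict Ω) :=
      (((hψ.continuous_fderiv (by simp)).clm_apply continuous_const).memLp_of_hasCompactSupport
        (hψc.fderiv_apply (𝕜 := ℝ) _)).restrict _
    have l1 := tendsto_integral_mul_of_tendsto_eLpNorm_two
      (fun k => (hv k).locInt.aestronglyMeasurable) hu hψd h1
    have l2 := tendsto_integral_mul_of_tendsto_eLpNorm_two (f := fun k x => H k x i)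
      (fun k => (locallyIntegrableOn_coord (hv k).locIntGrad i).aestronglyMeasurable) hGi hψm
      (tendsto_of_tendsto_of_tendsto_of_le_of_le tendsto_const_nhds h2 (fun _ => zero_le)
        fun k => eLpNorm_coord_le (fun x => H k x - G x) 2 i)
    simp only [fun k => (hv k).eq ψ hψ hψc hψs i] at l1
    exact tendsto_nhds_unique l1 l2.neg

/-! ### The chain rule and traces of compositions -/

lemma tendsto_eLpNorm_two_of_dominated {α F : Type*} [MeasurableSpace α] [NormedAddCommGroup F]
    {μ : Measure α} {f : ℕ → α → F} {bound : α → ℝ} (hf : ∀ k, AEStronglyMeasurable (f k) μ)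
    (hbound : MemLp bound 2 μ) (hle : ∀ k x, ‖f k x‖ ≤ bound x)
    (h : ∀ᵐ x ∂μ, Tendsto (fun k => f k x) atTop (𝓝 0)) :
    Tendsto (fun k => eLpNorm (f k) 2 μ) atTop (𝓝 0) := by
  simp only [eLpNorm_eq_lintegral_rpow_enorm_toReal (p := 2) (by norm_num) (by norm_num)]
  have h1 : Tendsto (fun k => ∫⁻ x, ‖f k x‖ₑ ^ (2 : ℝ≥0∞).toReal ∂μ) atTop (𝓝 (∫⁻ _, 0 ∂μ)) := by
    refine tendsto_lintegral_of_dominated_convergence'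
      (fun x => ‖bound x‖ₑ ^ (2 : ℝ≥0∞).toReal) (fun k => (hf k).enorm.pow_const _) ?_ ?_ ?_
    · refine fun k => Eventually.of_forall fun x => ?_
      refine ENNReal.rpow_le_rpow ?_ (by simp)
      rw [enorm_le_iff_norm_le]
      exact (hle k x).trans (le_abs_self _)
    · exact (lintegral_rpow_enorm_lt_top_of_eLpNorm_lt_top (by norm_num) (by norm_num) hbound.2).ne
    · filter_upwards [h] with x hx
      have h2 : Tendsto (fun k => ‖f k x‖ₑ) atTop (𝓝 0) := by simpa using hx.enorm
      have h3 := (ENNReal.continuous_rpow_const (y := (2 : ℝ≥0∞).toReal)).tendsto 0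
      rw [ENNReal.zero_rpow_of_pos (by norm_num)] at h3
      exact h3.comp h2
  rw [lintegral_zero] at h1
  have h3 := (ENNReal.continuous_rpow_const (y := 1 / (2 : ℝ≥0∞).toReal)).tendsto 0
  rw [ENNReal.zero_rpow_of_pos (by norm_num)] at h3
  exact h3.comp h1

lemma gradient_comp {N : ℕ} {Ψ : ℝ → ℝ} {φ : E N → ℝ} {x : E N} (hΨ : DifferentiableAt ℝ Ψ (φ x))
    (hφ : DifferentiableAt ℝ φ x) :
    gradient (fun y => Ψ (φ y)) x = deriv Ψ (φ x) • gradient φ x := by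
  have h : fderiv ℝ (fun y => Ψ (φ y)) x = deriv Ψ (φ x) • fderiv ℝ φ x :=
    (hΨ.hasDerivAt.comp_hasFDerivAt x hφ.hasFDerivAt).fderiv
  rw [gradient, h, map_smul, gradient]

lemma eLpNorm_comp_sub_comp_le {α : Type*} [MeasurableSpace α] {μ : Measure α} {Ψ : ℝ → ℝ}
    {M : ℝ≥0} (hΨ : LipschitzWith M Ψ) (f g : α → ℝ) (p : ℝ≥0∞) :
    eLpNorm (fun x => Ψ (f x) - Ψ (g x)) p μ ≤ M * eLpNorm (fun x => f x - g x) p μ := by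
  have h := eLpNorm_le_nnreal_smul_eLpNorm_of_ae_le_mul (μ := μ) (f := fun x => Ψ (f x) - Ψ (g x))
    (g := fun x => f x - g x) (c := M) (Eventually.of_forall fun x => by
      have := hΨ.nndist_le (f x) (g x)
      rwa [nndist_eq_nnnorm, nndist_eq_nnnorm] at this) p
  simpa [ENNReal.smul_def] using h

/-- The chain rule in `H¹(Ω)`, together with the trace of the composition. -/
lemma HasTrace.comp {N : ℕ} {Ω : Set (E N)} (hΩ : IsOpen Ω) (hΩb : Bornology.IsBounded Ω)
    {u : E N → ℝ} {G : E N → E N} {g : Lp ℝ 2 (surf Ω)} (hu : HasTrace Ω u g)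
    (hG : HasWeakGradient Ω u G) {Ψ : ℝ → ℝ} {M : ℝ≥0} (hΨ : ContDiff ℝ 1 Ψ)
    (hΨL : LipschitzWith M Ψ) (hΨ0 : Ψ 0 = 0) :
    HasTrace Ω (fun x => Ψ (u x)) (hΨL.compLp hΨ0 g) ∧
      HasWeakGradient Ω (fun x => Ψ (u x)) (fun x => deriv Ψ (u x) • G x) := by
  have hu2 := hu.1.1
  have hG2 := hu.1.memLp_of_hasWeakGradient hΩ hG
  obtain ⟨φ₀, hφ₀⟩ := hu.exists_isTraceApprox hΩ hG
  obtain ⟨n, _, hφ, hae⟩ := hφ₀.exists_ae_tendsto hu2.aestronglyMeasurable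
  set φ := fun k => φ₀ (n k) with hφdef
  have hΨ' : Continuous (deriv Ψ) := hΨ.continuous_deriv (by norm_num)
  have hΨM : ∀ s, ‖deriv Ψ s‖ ≤ M := fun s => norm_deriv_le_of_lipschitz hΨL
  have hC1 : ∀ k, ContDiff ℝ 1 fun x => Ψ (φ k x) := fun k => hΨ.comp (hφ.contDiff k)
  have hgrad : ∀ k x, gradient (fun y => Ψ (φ k y)) x = deriv Ψ (φ k x) • gradient (φ k) x :=
    fun k x => gradient_comp ((hΨ.differentiable (by norm_num)) _)
      (((hφ.contDiff k).differentiable (by norm_num)) x)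
  have hdu : AEStronglyMeasurable (fun x => deriv Ψ (u x)) (volume.restrict Ω) :=
    hΨ'.comp_aestronglyMeasurable hu2.aestronglyMeasurable
  have hvmem : MemLp (fun x => Ψ (u x)) 2 (volume.restrict Ω) := hΨL.comp_memLp hΨ0 hu2
  have hHmem : MemLp (fun x => deriv Ψ (u x) • G x) 2 (volume.restrict Ω) := by
    refine MemLp.of_le_mul (c := M) hG2 (hdu.smul hG2.aestronglyMeasurable)
      (Eventually.of_forall fun x => ?_)
    rw [norm_smul]
    exact mul_le_mul_of_nonneg_right (hΨM _) (norm_nonneg _)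
  have t1 : Tendsto (fun k => eLpNorm (fun x => Ψ (φ k x) - Ψ (u x)) 2 (volume.restrict Ω))
      atTop (𝓝 0) := by
    refine tendsto_of_tendsto_of_tendsto_of_le_of_le tendsto_const_nhds ?_ (fun _ => zero_le)
      fun k => eLpNorm_comp_sub_comp_le hΨL (φ k) u 2
    simpa using ENNReal.Tendsto.const_mul hφ.tendsto (Or.inr (ENNReal.coe_ne_top (r := M)))
  -- The difference splits as `Ψ'(φ_k)(∇φ_k - G) + (Ψ'(φ_k) - Ψ'(u)) G`. The first term uses the
  -- bound on `Ψ'`; as `Ψ'` is only continuous, the second uses dominated convergence with majorant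
  -- `2M‖G‖`.
  have t2 : Tendsto (fun k => eLpNorm (fun x => gradient (fun y => Ψ (φ k y)) x -
      deriv Ψ (u x) • G x) 2 (volume.restrict Ω)) atTop (𝓝 0) := by
    have hφm : ∀ k, AEStronglyMeasurable (fun x => deriv Ψ (φ k x)) (volume.restrict Ω) :=
      fun k => (hΨ'.comp (hφ.contDiff k).continuous).aestronglyMeasurable
    have hgm : ∀ k, AEStronglyMeasurable (fun x => gradient (φ k) x - G x) (volume.restrict Ω) :=
      fun k => (continuous_gradient (hφ.contDiff k)).aestronglyMeasurable.sub
        hG2.aestronglyMeasurable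
    have s1 : Tendsto (fun k => eLpNorm (fun x => deriv Ψ (φ k x) • (gradient (φ k) x - G x)) 2
        (volume.restrict Ω)) atTop (𝓝 0) := by
      refine tendsto_of_tendsto_of_tendsto_of_le_of_le tendsto_const_nhds
        (h := fun k => (M : ℝ≥0∞) * eLpNorm (fun x => gradient (φ k) x - G x) 2 (volume.restrict Ω))
        ?_ (fun _ => zero_le) fun k => ?_
      · simpa using ENNReal.Tendsto.const_mul hφ.tendsto_gradient
          (Or.inr (ENNReal.coe_ne_top (r := M)))
      · have := eLpNorm_le_nnreal_smul_eLpNorm_of_ae_le_mul (μ := volume.restrict Ω)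
          (f := fun x => deriv Ψ (φ k x) • (gradient (φ k) x - G x))
          (g := fun x => gradient (φ k) x - G x) (c := M) (Eventually.of_forall fun x => by
            rw [nnnorm_smul]
            exact mul_le_mul_of_nonneg_right (NNReal.coe_le_coe.1 (hΨM _)) zero_le) 2
        simpa [ENNReal.smul_def] using this
    have s2 : Tendsto (fun k => eLpNorm (fun x => (deriv Ψ (φ k x) - deriv Ψ (u x)) • G x) 2
        (volume.restrict Ω)) atTop (𝓝 0) := by
      refine tendsto_eLpNorm_two_of_dominated (bound := fun x => (2 * M) * ‖G x‖)
        (fun k => ((hφm k).sub hdu).smul hG2.aestronglyMeasurable) (hG2.norm.const_mul _)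
        (fun k x => ?_) ?_
      · rw [norm_smul]
        refine mul_le_mul_of_nonneg_right ?_ (norm_nonneg _)
        linarith [norm_sub_le (deriv Ψ (φ k x)) (deriv Ψ (u x)), hΨM (φ k x), hΨM (u x)]
      · filter_upwards [hae] with x hx
        have h1 : Tendsto (fun k => deriv Ψ (φ k x) - deriv Ψ (u x)) atTop (𝓝 0) := by
          simpa using ((hΨ'.tendsto (u x)).comp hx).sub_const (deriv Ψ (u x))
        simpa using h1.smul_const (G x)
    refine tendsto_of_tendsto_of_tendsto_of_le_of_le tendsto_const_nhds
      (by simpa using s1.add s2) (fun _ => zero_le) fun k => ?_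
    have e : (fun x => gradient (fun y => Ψ (φ k y)) x - deriv Ψ (u x) • G x) =
        (fun x => deriv Ψ (φ k x) • (gradient (φ k) x - G x)) +
          fun x => (deriv Ψ (φ k x) - deriv Ψ (u x)) • G x := by
      ext1 x
      rw [hgrad, Pi.add_apply]
      module
    rw [e]
    exact eLpNorm_add_le ((hφm k).smul (hgm k))
      (((hφm k).sub hdu).smul hG2.aestronglyMeasurable) (by norm_num)
  have hw : HasWeakGradient Ω (fun x => Ψ (u x)) (fun x => deriv Ψ (u x) • G x) :=
    hasWeakGradient_of_tendsto hΩb (fun k => hasWeakGradient_gradient Ω (hC1 k)) hvmem hHmem t1 t2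
  refine ⟨⟨⟨hvmem, _, hw, hHmem⟩, fun k x => Ψ (φ k x), hC1, ?_, ?_⟩, hw⟩
  · refine tendsto_of_tendsto_of_tendsto_of_le_of_le tendsto_const_nhds
      (h := fun k => eLpNorm (fun x => Ψ (φ k x) - Ψ (u x)) 2 (volume.restrict Ω) +
        N * eLpNorm (fun x => gradient (fun y => Ψ (φ k y)) x - deriv Ψ (u x) • G x) 2
          (volume.restrict Ω)) ?_ (fun _ => zero_le) fun k =>
        ((hasWeakGradient_gradient Ω (hC1 k)).sub hw).w1Norm_le 2
    simpa using t1.add (ENNReal.Tendsto.const_mul t2 (Or.inr (ENNReal.natCast_ne_top N)))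
  · have e : ∀ k, eLpNorm (fun x => Ψ (φ k x) - (hΨL.compLp hΨ0 g : Lp ℝ 2 (surf Ω)) x) 2 (surf Ω) =
        eLpNorm (fun x => Ψ (φ k x) - Ψ (g x)) 2 (surf Ω) := by
      intro k
      refine eLpNorm_congr_ae ?_
      filter_upwards [hΨL.coeFn_compLp hΨ0 g] with x hx
      rw [hx, Function.comp_apply]
    simp only [e]
    refine tendsto_of_tendsto_of_tendsto_of_le_of_le tendsto_const_nhds ?_ (fun _ => zero_le)
      fun k => eLpNorm_comp_sub_comp_le hΨL (φ k) g 2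
    simpa using ENNReal.Tendsto.const_mul hφ.tendsto_trace (Or.inr (ENNReal.coe_ne_top (r := M)))

/-! ### From charts to the whole domain -/

section Global

variable {N : ℕ} {Ω K K' : Set (E N)} {b b' : E N} {ρ ρ' : ℝ}

lemma IsTraceChart.poincare_sobolev (hN : 3 ≤ N) (hΩ : IsBoundedLipschitzDomain Ω)
    (hK : IsTraceChart Ω K b ρ) {p : ℝ} (hp : 2 ≤ p) (hpN : 1 / 2 - 1 / (N : ℝ) < 1 / p) :
    ∃ C : ℝ≥0, ∀ φ : E N → ℝ, ContDiff ℝ 1 φ →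
      eLpNorm (fun x => φ x - ⨍ y in Metric.ball b ρ, φ y) (ENNReal.ofReal p)
        (volume.restrict (K ∩ Ω)) ≤ C * eLpNorm (fderiv ℝ φ) 2 (volume.restrict Ω) := by
  obtain ⟨C, hC⟩ := hK.starShaped.poincare_sobolev hN (hK.isOpen.inter hΩ.isOpen)
    (hΩ.isBounded.subset inter_subset_right) hp hpN
  refine ⟨C, fun φ hφ => (hC φ hφ).trans (mul_le_mul_right ?_ _)⟩
  exact eLpNorm_mono_measure _ (Measure.restrict_mono inter_subset_right le_rfl)

lemma IsTraceChart.poincare (hN : 3 ≤ N) (hΩ : IsBoundedLipschitzDomain Ω)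
    (hK : IsTraceChart Ω K b ρ) :
    ∃ C : ℝ≥0, ∀ φ : E N → ℝ, ContDiff ℝ 1 φ →
      eLpNorm (fun x => φ x - ⨍ y in Metric.ball b ρ, φ y) 2
        (volume.restrict (K ∩ Ω)) ≤ C * eLpNorm (fderiv ℝ φ) 2 (volume.restrict Ω) := by
  have hN0 : (0 : ℝ) < N := by positivity
  simpa using hK.poincare_sobolev hN hΩ (p := 2) le_rfl (by simpa using hN0)

/-- With `c` the average, the chart's trace inequality leaves `L¹` norms over a set of finite
measure; Cauchy–Schwarz and the `L²` Poincaré inequality control them. -/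
lemma IsTraceChart.trace_poincare (hN : 3 ≤ N) (hΩ : IsBoundedLipschitzDomain Ω)
    (hK : IsTraceChart Ω K b ρ) :
    ∃ C : ℝ≥0, ∀ φ : E N → ℝ, ContDiff ℝ 1 φ →
      ∫⁻ x in K, ‖φ x - ⨍ y in Metric.ball b ρ, φ y‖ₑ ∂(surf Ω) ≤
        C * eLpNorm (fderiv ℝ φ) 2 (volume.restrict Ω) := by
  obtain ⟨C, hC⟩ := hK.poincare hN hΩ
  obtain ⟨C', hC'⟩ := hK.trace
  set m : ℝ≥0∞ := volume (K ∩ Ω) ^ (1 / 2 : ℝ) with hm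
  have hmt : m ≠ ⊤ := ENNReal.rpow_ne_top_of_nonneg (by norm_num)
    (hΩ.isBounded.subset inter_subset_right).measure_lt_top.ne
  have hL1 : ∀ {F : Type} [NormedAddCommGroup F] (f : E N → F), Continuous f →
      ∫⁻ x in K ∩ Ω, ‖f x‖ₑ ≤ eLpNorm f 2 (volume.restrict (K ∩ Ω)) * m := by
    intro F _ f hf
    rw [← eLpNorm_one_eq_lintegral_enorm]
    have hfm : AEStronglyMeasurable f (volume.restrict (K ∩ Ω)) := hf.aestronglyMeasurable
    have h1 : (1 : ℝ≥0∞) ≤ 2 := by norm_num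
    refine (eLpNorm_le_eLpNorm_mul_rpow_measure_univ h1 hfm).trans (le_of_eq ?_)
    rw [Measure.restrict_apply_univ, hm]
    norm_num
  refine ⟨C' * ((C + 1) * m.toNNReal), fun φ hφ => (hC' φ hφ _).trans ?_⟩
  rw [ENNReal.coe_mul, mul_assoc]
  refine mul_le_mul_right ?_ _
  refine (add_le_add (hL1 _ (hφ.continuous.sub continuous_const))
    (hL1 _ (hφ.continuous_fderiv (by norm_num)))).trans ?_
  have h2 : eLpNorm (fderiv ℝ φ) 2 (volume.restrict (K ∩ Ω)) ≤
      eLpNorm (fderiv ℝ φ) 2 (volume.restrict Ω) :=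
    eLpNorm_mono_measure _ (Measure.restrict_mono inter_subset_right le_rfl)
  refine (add_le_add (mul_le_mul_left (hC φ hφ) m) (mul_le_mul_left h2 m)).trans (le_of_eq ?_)
  rw [ENNReal.coe_mul, ENNReal.coe_toNNReal hmt, ENNReal.coe_add, ENNReal.coe_one]
  ring

/-- The averages over two overlapping charts differ by at most the Dirichlet norm. -/
lemma IsTraceChart.average_sub_average_le (hN : 3 ≤ N) (hΩ : IsBoundedLipschitzDomain Ω)
    (hK : IsTraceChart Ω K b ρ) (hK' : IsTraceChart Ω K' b' ρ') (hne : (K ∩ K' ∩ Ω).Nonempty) :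
    ∃ C : ℝ≥0, ∀ φ : E N → ℝ, ContDiff ℝ 1 φ →
      ‖(⨍ y in Metric.ball b ρ, φ y) - ⨍ y in Metric.ball b' ρ', φ y‖ₑ ≤
        C * eLpNorm (fderiv ℝ φ) 2 (volume.restrict Ω) := by
  obtain ⟨C, hC⟩ := hK.poincare hN hΩ
  obtain ⟨C', hC'⟩ := hK'.poincare hN hΩ
  -- The overlap is open and nonempty, so it has positive measure and the constant `a - a'` can be
  -- measured by its `L²` norm there.
  set V := K ∩ K' ∩ Ω with hV
  have hVpos : 0 < volume V :=
    ((hK.isOpen.inter hK'.isOpen).inter hΩ.isOpen).measure_pos volume hne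
  have hVt : volume V < ⊤ := (hΩ.isBounded.subset inter_subset_right).measure_lt_top
  set m : ℝ≥0∞ := volume V ^ (1 / 2 : ℝ) with hm
  have hm0 : m ≠ 0 := (ENNReal.rpow_pos hVpos hVt.ne).ne'
  have hmt : m ≠ ⊤ := ENNReal.rpow_ne_top_of_nonneg (by norm_num) hVt.ne
  refine ⟨(m⁻¹).toNNReal * (C' + C), fun φ hφ => ?_⟩
  rw [ENNReal.coe_mul, ENNReal.coe_toNNReal (ENNReal.inv_ne_top.2 hm0), mul_assoc]
  set a := ⨍ y in Metric.ball b ρ, φ y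
  set a' := ⨍ y in Metric.ball b' ρ', φ y
  have h1 : ‖a - a'‖ₑ * m ≤ (C' + C) * eLpNorm (fderiv ℝ φ) 2 (volume.restrict Ω) := by
    have e1 : eLpNorm (fun _ : E N => a - a') 2 (volume.restrict V) = ‖a - a'‖ₑ * m := by
      rw [eLpNorm_const' _ (by norm_num) (by norm_num), Measure.restrict_apply_univ, hm]
      norm_num
    have e2 : (fun _ : E N => a - a') = (fun x => φ x - a') - fun x => φ x - a := by
      ext x
      simp
    rw [← e1, e2]
    refine (eLpNorm_sub_le ?_ ?_ (by norm_num)).trans ?_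
    · exact (hφ.continuous.sub continuous_const).aestronglyMeasurable
    · exact (hφ.continuous.sub continuous_const).aestronglyMeasurable
    rw [add_mul]
    refine add_le_add (le_trans ?_ (hC' φ hφ)) (le_trans ?_ (hC φ hφ))
    · exact eLpNorm_mono_measure _ (Measure.restrict_mono
        (show V ⊆ K' ∩ Ω from fun x hx => ⟨hx.1.2, hx.2⟩) le_rfl)
    · exact eLpNorm_mono_measure _ (Measure.restrict_mono
        (show V ⊆ K ∩ Ω from fun x hx => ⟨hx.1.1, hx.2⟩) le_rfl)
  calc ‖a - a'‖ₑ = m⁻¹ * (‖a - a'‖ₑ * m) := by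
        rw [mul_comm ‖_‖ₑ, ← mul_assoc, ENNReal.inv_mul_cancel hm0 hmt, one_mul]
    _ ≤ _ := by
        rw [ENNReal.coe_add]
        exact mul_le_mul_right h1 _

end Global

/-- The Poincaré–Sobolev inequality for `C¹` functions on a bounded Lipschitz domain, with a
control of the boundary values on a part of a given set of positive surface measure. -/
lemma IsBoundedLipschitzDomain.poincare_sobolev {N : ℕ} (hN : 3 ≤ N) {Ω : Set (E N)}
    (hΩ : IsBoundedLipschitzDomain Ω) {p : ℝ} (hp : 2 ≤ p)
    (hpN : 1 / 2 - 1 / (N : ℝ) < 1 / p) {S : Set (E N)} (hS : S ⊆ frontier Ω) (hS0 : 0 < surf Ω S) :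
    ∃ (C : ℝ≥0) (T : Set (E N)), T ⊆ S ∧ surf Ω T ≠ 0 ∧ surf Ω T ≠ ⊤ ∧
      ∀ φ : E N → ℝ, ContDiff ℝ 1 φ → ∃ c : ℝ,
        eLpNorm (fun x => φ x - c) (ENNReal.ofReal p) (volume.restrict Ω) ≤
            C * eLpNorm (fderiv ℝ φ) 2 (volume.restrict Ω) ∧
          ∫⁻ x in T, ‖φ x - c‖ₑ ∂(surf Ω) ≤
            C * eLpNorm (fderiv ℝ φ) 2 (volume.restrict Ω) := by
  classical
  choose! K b ρ hPK hK using fun (P : E N) (hP : P ∈ closure Ω) =>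
    hΩ.exists_isTraceChart (by omega) hP
  have hcomp : IsCompact (closure Ω) := hΩ.isBounded.isCompact_closure
  obtain ⟨s, hs, hcover⟩ := hcomp.elim_nhds_subcover K
    (fun x hx => (hK x hx).isOpen.mem_nhds (hPK x hx))
  -- a chart that meets `S` in positive measure
  obtain ⟨P₀, hP₀, hT0⟩ : ∃ P₀ ∈ closure Ω, surf Ω (S ∩ K P₀) ≠ 0 := by
    by_contra! hcon
    refine hS0.ne' (measure_mono_null (t := ⋃ x ∈ s, S ∩ K x) ?_ ?_)
    · intro x hx
      obtain ⟨y, hy, hxy⟩ := mem_iUnion₂.1 (hcover (frontier_subset_closure (hS hx)))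
      exact mem_iUnion₂.2 ⟨y, hy, hx, hxy⟩
    · exact (measure_biUnion_null_iff s.countable_toSet).2 fun x hx => hcon x (hs x hx)
  set a : E N → (E N → ℝ) → ℝ := fun x φ => ⨍ y in Metric.ball (b x) (ρ x), φ y with ha
  -- Being linked by such an estimate is symmetric and transitive. It also holds between nearby
  -- points of `closure Ω`, whose charts overlap in an open set around one of them and therefore
  -- meet inside `Ω`. Connectedness of `closure Ω` links all points.
  have hchain : ∀ x ∈ closure Ω, ∃ C : ℝ≥0, ∀ φ : E N → ℝ, ContDiff ℝ 1 φ →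
      ‖a x φ - a P₀ φ‖ₑ ≤ C * eLpNorm (fderiv ℝ φ) 2 (volume.restrict Ω) := by
    intro x hx
    refine hΩ.isConnected.closure.isPreconnected.induction₂
      (fun x y => ∃ C : ℝ≥0, ∀ φ : E N → ℝ, ContDiff ℝ 1 φ →
        ‖a x φ - a y φ‖ₑ ≤ C * eLpNorm (fderiv ℝ φ) 2 (volume.restrict Ω)) ?_ ?_ ?_ hx hP₀
    · intro x hx
      filter_upwards [self_mem_nhdsWithin,
        mem_nhdsWithin_of_mem_nhds ((hK x hx).isOpen.mem_nhds (hPK x hx))] with y hy hyK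
      refine (hK x hx).average_sub_average_le hN hΩ (hK y hy) ?_
      exact mem_closure_iff.1 hy _ ((hK x hx).isOpen.inter (hK y hy).isOpen) ⟨hyK, hPK y hy⟩
    · rintro x y z - - - ⟨C, hC⟩ ⟨C', hC'⟩
      refine ⟨C + C', fun φ hφ => ?_⟩
      rw [← sub_add_sub_cancel (a x φ) (a y φ) (a z φ), ENNReal.coe_add, add_mul]
      exact (enorm_add_le _ _).trans (add_le_add (hC φ hφ) (hC' φ hφ))
    · rintro x y - - ⟨C, hC⟩
      refine ⟨C, fun φ hφ => ?_⟩
      rw [← enorm_neg, neg_sub]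
      exact hC φ hφ
  choose! C₁ hC₁ using hchain
  choose! C₂ hC₂ using fun (x : E N) (hx : x ∈ closure Ω) =>
    (hK x hx).poincare_sobolev hN hΩ hp hpN
  obtain ⟨C₃, hC₃⟩ := (hK P₀ hP₀).trace_poincare hN hΩ
  have hp0 : 0 < p := by linarith
  have hp1 : 1 ≤ ENNReal.ofReal p := by
    rw [ENNReal.one_le_ofReal]
    linarith
  set m : ℝ≥0∞ := volume Ω ^ (1 / p) with hm
  have hmt : m ≠ ⊤ := ENNReal.rpow_ne_top_of_nonneg (by positivity) hΩ.isBounded.measure_lt_top.ne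
  -- `C₂` is the local Poincaré–Sobolev constant, `C₁` the cost of replacing the local average by
  -- that at `P₀`, with `m` the factor for the `Lᵖ` norm of a constant; `C₃` serves the boundary
  -- term.
  refine ⟨(∑ x ∈ s, (C₂ x + C₁ x * m.toNNReal)) + C₃, S ∩ K P₀, inter_subset_left, hT0,
    ne_top_of_le_ne_top (hK P₀ hP₀).surf_ne_top (measure_mono inter_subset_right),
    fun φ hφ => ⟨a P₀ φ, ?_, ?_⟩⟩
  · set δ := eLpNorm (fderiv ℝ φ) 2 (volume.restrict Ω)
    have hloc : ∀ x ∈ s, eLpNorm (fun y => φ y - a P₀ φ) (ENNReal.ofReal p)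
        (volume.restrict (K x ∩ Ω)) ≤ (C₂ x + C₁ x * m) * δ := by
      intro x hx
      have e : (fun y => φ y - a P₀ φ) = (fun y => φ y - a x φ) + fun _ => a x φ - a P₀ φ := by
        ext y
        simp
      rw [e, add_mul]
      refine (eLpNorm_add_le ?_ ?_ hp1).trans (add_le_add (hC₂ x (hs x hx) φ hφ) ?_)
      · exact (hφ.continuous.sub continuous_const).aestronglyMeasurable
      · exact aestronglyMeasurable_const
      · rw [eLpNorm_const' _ (by simpa using hp0) ENNReal.ofReal_ne_top,
          Measure.restrict_apply_univ, ENNReal.toReal_ofReal hp0.le, mul_right_comm]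
        exact mul_le_mul' (hC₁ x (hs x hx) φ hφ)
          (ENNReal.rpow_le_rpow (measure_mono inter_subset_right) (by positivity))
    have hsum : eLpNorm (fun y => φ y - a P₀ φ) (ENNReal.ofReal p) (volume.restrict Ω) ≤
        ∑ x ∈ s, eLpNorm (fun y => φ y - a P₀ φ) (ENNReal.ofReal p)
          (volume.restrict (K x ∩ Ω)) := by
      have hle : ∀ y ∈ Ω, ‖φ y - a P₀ φ‖ ≤
          ‖∑ x ∈ s, (K x ∩ Ω).indicator (fun y => ‖φ y - a P₀ φ‖) y‖ := by
        intro y hy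
        obtain ⟨x, hx, hyx⟩ := mem_iUnion₂.1 (hcover (subset_closure hy))
        have h1 : ‖φ y - a P₀ φ‖ = (K x ∩ Ω).indicator (fun y => ‖φ y - a P₀ φ‖) y := by
          rw [indicator_of_mem (show y ∈ K x ∩ Ω from ⟨hyx, hy⟩)]
        rw [h1]
        refine le_trans ?_ (le_abs_self _)
        exact Finset.single_le_sum (f := fun x => (K x ∩ Ω).indicator (fun y => ‖φ y - a P₀ φ‖) y)
          (fun x _ => indicator_nonneg (fun _ _ => norm_nonneg _) _) hx
      have hmeas : ∀ x ∈ s, MeasurableSet (K x ∩ Ω) := fun x hx =>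
        ((hK x (hs x hx)).isOpen.inter hΩ.isOpen).measurableSet
      have hcn : Continuous fun y => ‖φ y - a P₀ φ‖ := (hφ.continuous.sub continuous_const).norm
      calc eLpNorm (fun y => φ y - a P₀ φ) (ENNReal.ofReal p) (volume.restrict Ω)
          ≤ eLpNorm (fun y => ∑ x ∈ s, (K x ∩ Ω).indicator (fun y => ‖φ y - a P₀ φ‖) y)
              (ENNReal.ofReal p) (volume.restrict Ω) :=
            eLpNorm_mono_ae ((ae_restrict_iff' hΩ.isOpen.measurableSet).2 (Eventually.of_forall hle))
        _ = eLpNorm (∑ x ∈ s, (K x ∩ Ω).indicator (fun y => ‖φ y - a P₀ φ‖))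
              (ENNReal.ofReal p) (volume.restrict Ω) := by
            congr 1
            ext y
            simp
        _ ≤ ∑ x ∈ s, eLpNorm ((K x ∩ Ω).indicator (fun y => ‖φ y - a P₀ φ‖))
              (ENNReal.ofReal p) (volume.restrict Ω) :=
            eLpNorm_sum_le (fun x hx => hcn.aestronglyMeasurable.indicator (hmeas x hx)) hp1
        _ = _ := by
            refine Finset.sum_congr rfl fun x hx => ?_
            rw [eLpNorm_indicator_eq_eLpNorm_restrict (hmeas x hx),
              Measure.restrict_restrict (hmeas x hx), inter_assoc, inter_self, eLpNorm_norm]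
    refine (hsum.trans (Finset.sum_le_sum hloc)).trans ?_
    rw [← Finset.sum_mul, ENNReal.coe_add]
    refine mul_le_mul_left (le_trans (le_of_eq ?_) le_self_add) _
    push_cast
    rw [ENNReal.coe_toNNReal hmt]
  · refine (lintegral_mono' (Measure.restrict_mono inter_subset_right le_rfl) le_rfl).trans
      ((hC₃ φ hφ).trans (mul_le_mul_left ?_ _))
    rw [ENNReal.coe_add]
    exact le_add_self

/-- The Poincaré–Sobolev inequality for functions in `H¹(Ω)` whose trace vanishes on a set of
positive surface measure. -/
lemma IsBoundedLipschitzDomain.poincare_sobolev_of_hasTrace {N : ℕ} (hN : 3 ≤ N) {Ω : Set (E N)}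
    (hΩ : IsBoundedLipschitzDomain Ω) {p : ℝ} (hp : 2 ≤ p)
    (hpN : 1 / 2 - 1 / (N : ℝ) < 1 / p) {S : Set (E N)} (hS : S ⊆ frontier Ω) (hS0 : 0 < surf Ω S) :
    ∃ C : ℝ≥0, ∀ (w : E N → ℝ) (W : E N → E N) (g : Lp ℝ 2 (surf Ω)), HasTrace Ω w g →
      HasWeakGradient Ω w W → g =ᵐ[(surf Ω).restrict S] 0 →
        eLpNorm w (ENNReal.ofReal p) (volume.restrict Ω) ≤
          C * eLpNorm W 2 (volume.restrict Ω) := by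
  obtain ⟨C, T, hTS, hT0, hTt, hC⟩ := hΩ.poincare_sobolev hN hp hpN hS hS0
  have hp0 : 0 < p := by linarith
  have hp1 : 1 ≤ ENNReal.ofReal p := by
    rw [ENNReal.one_le_ofReal]
    linarith
  set m : ℝ≥0∞ := volume Ω ^ (1 / p) with hm
  have hmt : m ≠ ⊤ := ENNReal.rpow_ne_top_of_nonneg (by positivity) hΩ.isBounded.measure_lt_top.ne
  set τ : ℝ≥0∞ := surf Ω T with hτ
  have hτm : τ ^ (1 / 2 : ℝ) ≠ ⊤ := ENNReal.rpow_ne_top_of_nonneg (by norm_num) hTt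
  set A : ℝ≥0∞ := C + τ⁻¹ * C * m with hA
  set B : ℝ≥0∞ := τ⁻¹ * τ ^ (1 / 2 : ℝ) * m with hB
  have hτi : τ⁻¹ ≠ ⊤ := ENNReal.inv_ne_top.2 hT0
  have hAt : A ≠ ⊤ := ENNReal.add_ne_top.2 ⟨ENNReal.coe_ne_top,
    ENNReal.mul_ne_top (ENNReal.mul_ne_top hτi ENNReal.coe_ne_top) hmt⟩
  have hBt : B ≠ ⊤ := ENNReal.mul_ne_top (ENNReal.mul_ne_top hτi hτm) hmt
  refine ⟨A.toNNReal, fun w W g hw hW hg => ?_⟩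
  rw [ENNReal.coe_toNNReal hAt]
  obtain ⟨φ₀, hφ₀⟩ := hw.exists_isTraceApprox hΩ.isOpen hW
  obtain ⟨n, _, hφ, hae⟩ := hφ₀.exists_ae_tendsto hw.1.1.aestronglyMeasurable
  set φ := fun k => φ₀ (n k) with hφdef
  have hWm : AEStronglyMeasurable W (volume.restrict Ω) := hW.locIntGrad.aestronglyMeasurable
  set ε : ℕ → ℝ≥0∞ := fun k => eLpNorm (fun x => φ k x - g x) 2 (surf Ω) with hε
  set ζ : ℕ → ℝ≥0∞ := fun k => eLpNorm (fun x => gradient (φ k) x - W x) 2 (volume.restrict Ω)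
    with hζ
  have hgT : g =ᵐ[(surf Ω).restrict T] 0 := hg.filter_mono
    (ae_mono (Measure.restrict_mono hTS le_rfl))
  have hbound : ∀ k, eLpNorm (φ k) (ENNReal.ofReal p) (volume.restrict Ω) ≤
      A * (ζ k + eLpNorm W 2 (volume.restrict Ω)) + B * ε k := by
    intro k
    have hφk := hφ.contDiff k
    set δ := eLpNorm (fderiv ℝ (φ k)) 2 (volume.restrict Ω) with hδ
    have hδle : δ ≤ ζ k + eLpNorm W 2 (volume.restrict Ω) := by
      have e1 : δ = eLpNorm (gradient (φ k)) 2 (volume.restrict Ω) :=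
        eLpNorm_congr_enorm_ae (Eventually.of_forall fun x => (enorm_gradient (φ k) x).symm)
      have e2 : gradient (φ k) = (fun x => gradient (φ k) x - W x) + W := by
        ext x : 1
        simp
      rw [e1, e2]
      exact eLpNorm_add_le ((continuous_gradient hφk).aestronglyMeasurable.sub hWm) hWm
        (by norm_num)
    obtain ⟨c, hc1, hc2⟩ := hC (φ k) hφk
    -- Since `g = 0` on `T`, there `‖c‖ ≤ ‖φ_k - c‖ + ‖φ_k - g‖`. This bounds the free constant by
    -- the gradient and the trace error.
    have hcτ : ‖c‖ₑ * τ ≤ C * δ + ε k * τ ^ (1 / 2 : ℝ) := by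
      have h1 : ∫⁻ x in T, ‖φ k x - g x‖ₑ ∂(surf Ω) ≤ ε k * τ ^ (1 / 2 : ℝ) := by
        rw [← eLpNorm_one_eq_lintegral_enorm]
        have hm1 : AEStronglyMeasurable (fun x => φ k x - g x) ((surf Ω).restrict T) :=
          (hφk.continuous.aestronglyMeasurable.sub (Lp.aestronglyMeasurable g)).restrict
        refine (eLpNorm_le_eLpNorm_mul_rpow_measure_univ (q := 2) (by norm_num) hm1).trans ?_
        rw [Measure.restrict_apply_univ]
        refine mul_le_mul' (eLpNorm_mono_measure _ Measure.restrict_le_self) (le_of_eq ?_)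
        norm_num [hτ]
      calc ‖c‖ₑ * τ = ∫⁻ _ in T, ‖c‖ₑ ∂(surf Ω) := by simp [hτ]
        _ ≤ ∫⁻ x in T, (‖φ k x - c‖ₑ + ‖φ k x - g x‖ₑ) ∂(surf Ω) := by
            refine lintegral_mono_ae ?_
            filter_upwards [hgT] with x hx
            rw [hx, Pi.zero_apply, sub_zero]
            calc ‖c‖ₑ = ‖φ k x - (φ k x - c)‖ₑ := by rw [sub_sub_cancel]
              _ ≤ ‖φ k x‖ₑ + ‖φ k x - c‖ₑ := enorm_sub_le
              _ = _ := add_comm _ _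
        _ = (∫⁻ x in T, ‖φ k x - c‖ₑ ∂(surf Ω)) + ∫⁻ x in T, ‖φ k x - g x‖ₑ ∂(surf Ω) :=
            lintegral_add_left (hφk.continuous.sub continuous_const).enorm.measurable _
        _ ≤ _ := add_le_add hc2 h1
    have hcle : ‖c‖ₑ ≤ τ⁻¹ * C * δ + τ⁻¹ * τ ^ (1 / 2 : ℝ) * ε k := by
      calc ‖c‖ₑ = τ⁻¹ * (‖c‖ₑ * τ) := by
            rw [mul_comm ‖_‖ₑ, ← mul_assoc, ENNReal.inv_mul_cancel hT0 hTt, one_mul]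
        _ ≤ τ⁻¹ * (C * δ + ε k * τ ^ (1 / 2 : ℝ)) := mul_le_mul_right hcτ _
        _ = _ := by ring
    have e3 : φ k = (fun x => φ k x - c) + fun _ => c := by
      ext x
      simp
    calc eLpNorm (φ k) (ENNReal.ofReal p) (volume.restrict Ω)
        ≤ eLpNorm (fun x => φ k x - c) (ENNReal.ofReal p) (volume.restrict Ω) +
            eLpNorm (fun _ => c) (ENNReal.ofReal p) (volume.restrict Ω) := by
          conv_lhs => rw [e3]
          exact eLpNorm_add_le (hφk.continuous.sub continuous_const).aestronglyMeasurable
            aestronglyMeasurable_const hp1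
      _ ≤ C * δ + (τ⁻¹ * C * δ + τ⁻¹ * τ ^ (1 / 2 : ℝ) * ε k) * m := by
          refine add_le_add hc1 ?_
          rw [eLpNorm_const' _ (by simpa using hp0) ENNReal.ofReal_ne_top,
            Measure.restrict_apply_univ, ENNReal.toReal_ofReal hp0.le]
          exact mul_le_mul_left hcle _
      _ = A * δ + B * ε k := by rw [hA, hB]; ring
      _ ≤ _ := add_le_add (mul_le_mul_right hδle _) le_rfl
  -- Fatou's lemma: the approximation is in `H¹` only, so convergence of `φ k` in `Lᵖ` is not at
  -- hand, but almost everywhere convergence suffices.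
  refine (Lp.eLpNorm_lim_le_liminf_eLpNorm
    (fun k => (hφ.contDiff k).continuous.aestronglyMeasurable) w hae).trans ?_
  have hlim : Tendsto (fun k => A * (ζ k + eLpNorm W 2 (volume.restrict Ω)) + B * ε k) atTop
      (𝓝 (A * eLpNorm W 2 (volume.restrict Ω))) := by
    have h1 := ENNReal.Tendsto.const_mul
      (hφ.tendsto_gradient.add_const (eLpNorm W 2 (volume.restrict Ω))) (Or.inr hAt)
    have h2 := ENNReal.Tendsto.const_mul hφ.tendsto_trace (Or.inr hBt)
    simpa using h1.add h2
  rw [← hlim.liminf_eq]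
  exact liminf_le_liminf (Eventually.of_forall hbound)

/-! ### The nonlinear test functions -/

/-- The primitive of `(1 + t²) ^ (-a)` that vanishes at `0`. -/
def bracketPrim (a s : ℝ) : ℝ := ∫ t in (0 : ℝ)..s, (1 + t ^ 2) ^ (-a)

lemma continuous_bracket (a : ℝ) : Continuous fun t : ℝ => (1 + t ^ 2) ^ a :=
  Continuous.rpow_const (by fun_prop) fun t => Or.inl (by positivity)

lemma bracketPrim_zero (a : ℝ) : bracketPrim a 0 = 0 := by simp [bracketPrim]

lemma hasDerivAt_bracketPrim (a s : ℝ) : HasDerivAt (bracketPrim a) ((1 + s ^ 2) ^ (-a)) s :=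
  intervalIntegral.integral_hasDerivAt_right ((continuous_bracket _).intervalIntegrable _ _)
    ((continuous_bracket _).stronglyMeasurableAtFilter _ _) (continuous_bracket _).continuousAt

lemma deriv_bracketPrim (a s : ℝ) : deriv (bracketPrim a) s = (1 + s ^ 2) ^ (-a) :=
  (hasDerivAt_bracketPrim a s).deriv

lemma contDiff_bracketPrim (a : ℝ) : ContDiff ℝ 1 (bracketPrim a) := by
  rw [contDiff_one_iff_deriv]
  refine ⟨fun s => (hasDerivAt_bracketPrim a s).differentiableAt, ?_⟩
  rw [funext (deriv_bracketPrim a)]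
  exact continuous_bracket _

lemma lipschitzWith_bracketPrim {a : ℝ} (ha : 0 ≤ a) : LipschitzWith 1 (bracketPrim a) := by
  refine lipschitzWith_of_nnnorm_deriv_le
    (fun s => (hasDerivAt_bracketPrim a s).differentiableAt) fun s => ?_
  rw [deriv_bracketPrim, ← NNReal.coe_le_coe, coe_nnnorm, Real.norm_of_nonneg (by positivity)]
  exact Real.rpow_le_one_of_one_le_of_nonpos (by nlinarith [sq_nonneg s]) (by linarith)

/-- The integrand decays like `|t|^(-2a)`, which is integrable for `2a > 1`. Boundedness is what
allows pairing the test function with sources controlled only in `L¹`. -/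
lemma exists_abs_bracketPrim_le {a : ℝ} (ha : 1 / 2 < a) : ∃ M : ℝ≥0, ∀ s, |bracketPrim a s| ≤ M := by
  have hint : Integrable fun t : ℝ => (1 + t ^ 2) ^ (-a) := by
    have h := integrable_rpow_neg_one_add_norm_sq (E := ℝ) (μ := volume) (r := 2 * a)
      (by simp; linarith)
    simpa [show -(2 * a) / 2 = -a by ring] using h
  refine ⟨(∫ t : ℝ, ‖(1 + t ^ 2) ^ (-a)‖).toNNReal, fun s => ?_⟩
  rw [Real.coe_toNNReal _ (integral_nonneg fun _ => norm_nonneg _), ← Real.norm_eq_abs]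
  refine intervalIntegral.norm_integral_le_integral_norm_uIoc.trans ?_
  exact setIntegral_le_integral hint.norm (Eventually.of_forall fun _ => norm_nonneg _)

/-- The integrand decreases in `|t|`, so on the interval from `0` to `s` it is at least its value at
`s`; negative `s` follows by oddness. -/
lemma le_abs_bracketPrim {a : ℝ} (ha : 0 ≤ a) (s : ℝ) :
    |s| * (1 + s ^ 2) ^ (-a) ≤ |bracketPrim a s| := by
  have hpos : ∀ s, 0 ≤ s → s * (1 + s ^ 2) ^ (-a) ≤ bracketPrim a s := by
    intro s hs
    have h := intervalIntegral.integral_mono_on (μ := volume) (f := fun _ => (1 + s ^ 2) ^ (-a))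
      (g := fun t => (1 + t ^ 2) ^ (-a)) hs (continuous_const.intervalIntegrable _ _)
      ((continuous_bracket _).intervalIntegrable _ _) fun t ht => by
        refine Real.rpow_le_rpow_of_nonpos (by positivity) ?_ (by linarith)
        nlinarith [ht.1, ht.2]
    simpa [bracketPrim] using h
  rcases le_total 0 s with hs | hs
  · rw [abs_of_nonneg hs]
    exact (hpos s hs).trans (le_abs_self _)
  · have hodd : bracketPrim a s = -bracketPrim a (-s) := by
      have h := intervalIntegral.integral_comp_neg (a := 0) (b := s)
        fun t : ℝ => (1 + t ^ 2) ^ (-a)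
      simp only [neg_sq, neg_zero] at h
      rw [bracketPrim, h, bracketPrim, intervalIntegral.integral_symm]
    rw [hodd, abs_neg, abs_of_nonpos hs]
    refine le_trans ?_ (le_abs_self _)
    simpa using hpos (-s) (by linarith)

/-- For `s² ≥ 1`, `|s|` is comparable to `(1 + s²)^(1/2)`, so `√2 |w|` dominates `(1 + s²)^(1/2 -
β)`; raising to the power `κ` gives exponent `β`. For `s² ≤ 1` the term `2 ^ β` suffices. -/
lemma bracket_le_of_le {β κ s w : ℝ} (hβ0 : 0 < β) (hβ : β < 1 / 2) (hκ : (1 / 2 - β) * κ = β)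
    (hw : |s| * (1 + s ^ 2) ^ (-β) ≤ |w|) :
    (1 + s ^ 2) ^ β ≤ 2 ^ β + (√2 * |w|) ^ κ := by
  have hκ0 : 0 ≤ κ := by
    by_contra! h
    nlinarith
  rcases le_total (s ^ 2) 1 with hs | hs
  · have h1 : (1 + s ^ 2) ^ β ≤ 2 ^ β := Real.rpow_le_rpow (by positivity) (by linarith) hβ0.le
    have h2 : 0 ≤ (√2 * |w|) ^ κ := by positivity
    linarith
  · have hb : 0 < 1 + s ^ 2 := by positivity
    have h1 : √(1 + s ^ 2) ≤ √2 * |s| := by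
      rw [← Real.sqrt_sq_eq_abs, ← Real.sqrt_mul (by norm_num)]
      exact Real.sqrt_le_sqrt (by linarith)
    have h2 : (1 + s ^ 2) ^ (1 / 2 - β) ≤ √2 * |w| := by
      rw [sub_eq_add_neg, Real.rpow_add hb, ← Real.sqrt_eq_rpow]
      calc √(1 + s ^ 2) * (1 + s ^ 2) ^ (-β) ≤ √2 * |s| * (1 + s ^ 2) ^ (-β) :=
            mul_le_mul_of_nonneg_right h1 (by positivity)
        _ = √2 * (|s| * (1 + s ^ 2) ^ (-β)) := by ring
        _ ≤ _ := mul_le_mul_of_nonneg_left hw (by positivity)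
    have h3 := Real.rpow_le_rpow (by positivity) h2 hκ0
    rw [← Real.rpow_mul hb.le, hκ] at h3
    have h4 : (0 : ℝ) ≤ 2 ^ β := by positivity
    linarith

/-! ### Weak-* convergence and total variation -/

/-- A weak-* convergent sequence of densities has bounded total variation. -/
lemma WeakStarTendsto.boundedVariation {N : ℕ} {Ω : Set (E N)} (hΩ : Bornology.IsBounded Ω)
    {μ : ℕ → E N → ℝ} (hμ : ∀ n, MemLp (μ n) ⊤ (volume.restrict Ω)) {ν : SignedMeasure (E N)}
    (h : WeakStarTendsto Ω μ ν) : BoundedVariation Ω μ := by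
  have := isFiniteMeasure_restrict_of_isBounded hΩ
  have hint : ∀ n, Integrable (μ n) (volume.restrict Ω) := fun n => (hμ n).integrable (by simp)
  have hgint : ∀ n (g : BoundedContinuousFunction (E N) ℝ),
      Integrable (fun x => g x * μ n x) (volume.restrict Ω) := fun n g =>
    (hint n).bdd_mul g.continuous.aestronglyMeasurable
      (Eventually.of_forall fun x => g.norm_coe_le_norm x)
  let T : ℕ → BoundedContinuousFunction (E N) ℝ →L[ℝ] ℝ := fun n =>
    LinearMap.mkContinuous
      { toFun := fun g => ∫ x in Ω, g x * μ n x
        map_add' := fun g g' => by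
          rw [← integral_add (hgint n g) (hgint n g')]
          simp [add_mul]
        map_smul' := fun c g => by
          rw [RingHom.id_apply, smul_eq_mul, ← integral_const_mul]
          simp [mul_assoc] }
      (∫ x in Ω, ‖μ n x‖) fun g => by
        change ‖∫ x in Ω, g x * μ n x‖ ≤ _
        rw [mul_comm, ← integral_const_mul]
        refine norm_integral_le_of_norm_le ((hint n).norm.const_mul _)
          (Eventually.of_forall fun x => ?_)
        rw [norm_mul]
        exact mul_le_mul_of_nonneg_right (g.norm_coe_le_norm x) (norm_nonneg _)
  have hT : ∀ n g, T n g = ∫ x in Ω, g x * μ n x := fun n g => rfl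
  -- Bounded continuous functions on the whole space form a Banach space and are admissible in the
  -- weak-* convergence; a convergent sequence of values is bounded.
  obtain ⟨C, hC⟩ := banach_steinhaus (g := T) fun g => by
    obtain ⟨C, hC⟩ := (Metric.isBounded_range_of_tendsto _
      (h g g.continuous.continuousOn)).exists_norm_le
    exact ⟨C, fun n => hC _ ⟨n, rfl⟩⟩
  refine ⟨C.toNNReal, fun n => ?_⟩
  have hC0 : 0 ≤ C := (norm_nonneg _).trans (hC n)
  obtain ⟨M, hM⟩ : ∃ M : ℝ≥0, ∀ᵐ x ∂(volume.restrict Ω), ‖μ n x‖ ≤ M := by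
    refine ⟨(eLpNormEssSup (μ n) (volume.restrict Ω)).toNNReal, ?_⟩
    have hfin : eLpNormEssSup (μ n) (volume.restrict Ω) ≠ ⊤ := by
      simpa using (hμ n).eLpNorm_ne_top
    filter_upwards [ae_le_eLpNormEssSup (f := μ n) (μ := volume.restrict Ω)] with x hx
    have := ENNReal.toReal_mono hfin hx
    rwa [toReal_enorm] at this
  set sg : E N → ℝ := fun x => Real.sign (μ n x) with hsg
  have hsgm : AEStronglyMeasurable sg (volume.restrict Ω) := by
    have hsm : Measurable Real.sign := by
      unfold Real.sign
      exact Measurable.ite (measurableSet_lt measurable_id measurable_const) measurable_const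
        (Measurable.ite (measurableSet_lt measurable_const measurable_id) measurable_const
          measurable_const)
    exact (hsm.comp_aemeasurable (hμ n).aestronglyMeasurable.aemeasurable).aestronglyMeasurable
  have hsg1 : ∀ x, |sg x| ≤ 1 := fun x => by
    rcases Real.sign_apply_eq (μ n x) with h | h | h <;> simp [hsg, h]
  have hsgL : MemLp sg 1 (volume.restrict Ω) :=
    MemLp.of_bound hsgm 1 (Eventually.of_forall hsg1)
  -- The sign of `μ n` is approximated in `L¹` by a continuous function, clipped to `[-1, 1]` so
  -- that its norm is at most `1`. The error is at most `M * ε`; here `M` depends on `n`, but it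
  -- disappears as `ε → 0`.
  have hkey : ∀ ε : ℝ≥0, 0 < ε → ∫ x in Ω, ‖μ n x‖ ≤ C + M * ε := by
    intro ε hε
    obtain ⟨g, hg, -⟩ := hsgL.exists_boundedContinuous_eLpNorm_sub_le (by simp)
      (ENNReal.coe_ne_zero.2 hε.ne')
    have hclip : ∀ t : ℝ, ‖max (-1) (min 1 t)‖ ≤ 1 := fun t => by
      rw [Real.norm_eq_abs, abs_le]
      exact ⟨le_max_left _ _, max_le (by norm_num) (min_le_left _ _)⟩
    let g' : BoundedContinuousFunction (E N) ℝ := BoundedContinuousFunction.ofNormedAddCommGroup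
      (fun x => max (-1) (min 1 (g x)))
      (continuous_const.max (continuous_const.min g.continuous)) 1 fun x => hclip _
    have hg' : ‖g'‖ ≤ 1 := (BoundedContinuousFunction.norm_le zero_le_one).2 fun x => hclip _
    -- Clipping is 1-Lipschitz and fixes the values of `sg`.
    have hdiff : ∀ x, ‖sg x - g' x‖ ≤ ‖sg x - g x‖ := fun x => by
      have h1 := abs_le.1 (hsg1 x)
      have h2 : sg x = max (-1) (min 1 (sg x)) := by
        rw [min_eq_right h1.2, max_eq_right h1.1]
      change ‖sg x - max (-1) (min 1 (g x))‖ ≤ _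
      conv_lhs => rw [h2]
      rw [Real.norm_eq_abs, Real.norm_eq_abs]
      refine (abs_max_sub_max_le_max _ _ _ _).trans ?_
      rw [sub_self, abs_zero, max_eq_right (abs_nonneg _)]
      refine (abs_min_sub_min_le_max _ _ _ _).trans ?_
      rw [sub_self, abs_zero, max_eq_right (abs_nonneg _)]
    have hgm : AEStronglyMeasurable g (volume.restrict Ω) := g.continuous.aestronglyMeasurable
    have hdL : Integrable (fun x => sg x - g x) (volume.restrict Ω) :=
      memLp_one_iff_integrable.1 ⟨hsgm.sub hgm, hg.trans_lt ENNReal.coe_lt_top⟩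
    have hdε : ∫ x in Ω, ‖sg x - g x‖ ≤ ε := by
      rw [integral_norm_eq_lintegral_enorm hdL.aestronglyMeasurable]
      rw [eLpNorm_one_eq_lintegral_enorm] at hg
      exact ENNReal.toReal_le_coe_of_le_coe hg
    have hsgμ : ∀ x, ‖μ n x‖ = g' x * μ n x + (sg x - g' x) * μ n x := fun x => by
      have : sg x * μ n x = |μ n x| := by
        rcases lt_trichotomy (μ n x) 0 with h | h | h
        · simp [hsg, Real.sign_of_neg h, abs_of_neg h]
        · simp [h]
        · simp [hsg, Real.sign_of_pos h, abs_of_pos h]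
      rw [Real.norm_eq_abs, ← this]
      ring
    have hint2 : Integrable (fun x => (sg x - g' x) * μ n x) (volume.restrict Ω) :=
      ((hint n).norm.sub (hgint n g')).congr (Eventually.of_forall fun x => by
        simp only [Pi.sub_apply, hsgμ x]
        ring)
    simp only [hsgμ]
    rw [integral_add (hgint n g') hint2]
    refine add_le_add ?_ ?_
    · calc ∫ x in Ω, g' x * μ n x = T n g' := rfl
        _ ≤ ‖T n g'‖ := le_abs_self _
        _ ≤ ‖T n‖ * ‖g'‖ := (T n).le_opNorm g'
        _ ≤ C * 1 := mul_le_mul (hC n) hg' (norm_nonneg _) hC0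
        _ = C := mul_one C
    · refine le_trans ?_ (mul_le_mul_of_nonneg_left hdε M.2)
      change _ ≤ (M : ℝ) * _
      rw [← integral_const_mul]
      refine integral_mono_ae hint2 (hdL.norm.const_mul _) ?_
      filter_upwards [hM] with x hx
      refine (le_abs_self _).trans ?_
      rw [abs_mul, mul_comm]
      exact mul_le_mul hx (hdiff x) (abs_nonneg _) M.2
  have hle : ∫ x in Ω, ‖μ n x‖ ≤ C := by
    refine le_of_forall_pos_le_add fun η hη => (hkey ⟨η / (M + 1), by positivity⟩
      (show 0 < η / (M + 1) by positivity)).trans (add_le_add le_rfl ?_)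
    change (M : ℝ) * (η / (M + 1)) ≤ η
    rw [mul_div_assoc', div_le_iff₀ (by positivity)]
    nlinarith [M.2]
  rw [eLpNorm_one_eq_lintegral_enorm, ← ofReal_integral_norm_eq_lintegral_enorm (hint n)]
  exact ENNReal.ofReal_le_ofReal hle

/-! ### The energy estimate for differences of solutions -/

lemma integrable_inner_of_memLp_two {α F : Type*} [MeasurableSpace α] [NormedAddCommGroup F]
    [InnerProductSpace ℝ F] {μ : Measure α} {f g : α → F} (hf : MemLp f 2 μ) (hg : MemLp g 2 μ) :
    Integrable (fun x => inner ℝ (f x) (g x)) μ :=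
  (hf.norm.integrable_mul hg.norm).mono' (hf.aestronglyMeasurable.inner hg.aestronglyMeasurable)
    (Eventually.of_forall fun x => norm_inner_le_norm (f x) (g x))

/-- The difference of two solutions with the same boundary data vanishes on `Γ₁`, and its energy
weighted by `Ψ'` is controlled by the sources. -/
lemma IsMixedSolution.exists_energy_le {N : ℕ} {Ω Γ₁ Γ₂ : Set (E N)}
    (hΩ : IsBoundedLipschitzDomain Ω) (hΓ : IsBoundaryDecomposition Ω Γ₁ Γ₂)
    {f₁ : E N → ℝ} {f₂ : HNegHalf Ω Γ₂} {ρ ρ' u u' : E N → ℝ}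
    (hρ : MemLp ρ ⊤ (volume.restrict Ω)) (hρ' : MemLp ρ' ⊤ (volume.restrict Ω))
    (hu : IsMixedSolution Ω Γ₁ Γ₂ ρ f₁ f₂ u) (hu' : IsMixedSolution Ω Γ₁ Γ₂ ρ' f₁ f₂ u') :
    ∃ (Z : E N → E N) (g : Lp ℝ 2 (surf Ω)),
      HasTrace Ω (fun x => u x - u' x) g ∧ HasWeakGradient Ω (fun x => u x - u' x) Z ∧
      MemLp Z 2 (volume.restrict Ω) ∧ g =ᵐ[(surf Ω).restrict Γ₁] 0 ∧
      ∀ (Ψ : ℝ → ℝ) (L M : ℝ≥0), ContDiff ℝ 1 Ψ → LipschitzWith L Ψ → Ψ 0 = 0 →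
        (∀ s, |Ψ s| ≤ M) →
        ∫ x in Ω, deriv Ψ (u x - u' x) * ‖Z x‖ ^ 2 ≤
          M * ((∫ x in Ω, ‖ρ x‖) + ∫ x in Ω, ‖ρ' x‖) := by
  have hfin := isFiniteMeasure_restrict_of_isBounded hΩ.isBounded
  obtain ⟨g, hg, hgf⟩ := hu.dirichlet
  obtain ⟨g', hg', hgf'⟩ := hu'.dirichlet
  obtain ⟨G, hG, hw⟩ := hu.weak
  obtain ⟨G', hG', hw'⟩ := hu'.weak
  have hG2 := hu.memH1.memLp_of_hasWeakGradient hΩ.isOpen hG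
  have hG2' := hu'.memH1.memLp_of_hasWeakGradient hΩ.isOpen hG'
  have htr : HasTrace Ω (fun x => u x - u' x) (g - g') := by
    have h := hg.add (hg'.const_smul (-1))
    simpa [sub_eq_add_neg] using h
  have hgr := hG.sub hG'
  set Z : E N → E N := fun x => G x - G' x with hZ
  have hZ2 : MemLp Z 2 (volume.restrict Ω) := hG2.sub hG2'
  have hzero : ((g - g' : Lp ℝ 2 (surf Ω)) : E N → ℝ) =ᵐ[(surf Ω).restrict Γ₁] 0 := by
    filter_upwards [ae_restrict_of_ae (Lp.coeFn_sub g g'), hgf, hgf'] with x h1 h2 h3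
    rw [h1, Pi.sub_apply, h2, h3, sub_self, Pi.zero_apply]
  refine ⟨Z, g - g', htr, hgr, hZ2, hzero, fun Ψ L M hΨ hΨL hΨ0 hΨM => ?_⟩
  set z : E N → ℝ := fun x => u x - u' x with hz
  obtain ⟨hT, hW⟩ := htr.comp hΩ.isOpen hΩ.isBounded hgr hΨ hΨL hΨ0
  have hW2 := hT.1.memLp_of_hasWeakGradient hΩ.isOpen hW
  -- Boundary points outside `closure Γ₂` lie in `Γ₁`, where the trace of the difference is zero,
  -- and `Ψ 0 = 0`.
  have hmem : hΨL.compLp hΨ0 (g - g') ∈ HTildeHalf Ω Γ₂ := by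
    refine ⟨⟨_, hT⟩, ?_⟩
    have hF : MeasurableSet (frontier Ω \ closure Γ₂) :=
      isClosed_frontier.measurableSet.diff isClosed_closure.measurableSet
    have hsub : frontier Ω \ closure Γ₂ ⊆ Γ₁ := by
      rw [← hΓ.closure_right]
      rintro x ⟨hx | hx, hx'⟩
      · exact hx
      · exact absurd hx hx'
    have h1 : ∀ᵐ x ∂(surf Ω), x ∈ frontier Ω \ closure Γ₂ → (g - g' : Lp ℝ 2 (surf Ω)) x = 0 :=
      (ae_restrict_iff' hF).1 (hzero.filter_mono (ae_mono (Measure.restrict_mono hsub le_rfl)))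
    have h2 : ∀ᵐ x ∂(surf Ω), x ∈ frontier Ω := ae_restrict_mem isClosed_frontier.measurableSet
    filter_upwards [h1, h2, hΨL.coeFn_compLp hΨ0 (g - g')] with x hx1 hx2 hx3 hx4
    rw [hx3, Function.comp_apply, hx1 ⟨hx2, hx4⟩, hΨ0]
  -- Both weak formulations are tested with `Ψ(z)`, so the values of `f₂` coincide and cancel on
  -- subtraction.
  have e := hw _ _ ⟨_, hmem⟩ hW hT
  have e' := hw' _ _ ⟨_, hmem⟩ hW hT
  have hi : Integrable (fun x => inner ℝ (G x) (deriv Ψ (z x) • Z x)) (volume.restrict Ω) :=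
    integrable_inner_of_memLp_two hG2 hW2
  have hi' : Integrable (fun x => inner ℝ (G' x) (deriv Ψ (z x) • Z x)) (volume.restrict Ω) :=
    integrable_inner_of_memLp_two hG2' hW2
  have hρi : Integrable ρ (volume.restrict Ω) := hρ.integrable (by simp)
  have hρi' : Integrable ρ' (volume.restrict Ω) := hρ'.integrable (by simp)
  have hbd : ∀ {r : E N → ℝ}, Integrable r (volume.restrict Ω) →
      |∫ x in Ω, Ψ (z x) * r x| ≤ M * ∫ x in Ω, ‖r x‖ := by
    intro r hr
    rw [← Real.norm_eq_abs, ← integral_const_mul]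
    refine norm_integral_le_of_norm_le (hr.norm.const_mul _) (Eventually.of_forall fun x => ?_)
    rw [norm_mul]
    exact mul_le_mul_of_nonneg_right (hΨM _) (norm_nonneg _)
  have hsum : ∫ x in Ω, deriv Ψ (z x) * ‖Z x‖ ^ 2 =
      (∫ x in Ω, Ψ (z x) * ρ x) - ∫ x in Ω, Ψ (z x) * ρ' x := by
    calc ∫ x in Ω, deriv Ψ (z x) * ‖Z x‖ ^ 2
        = ∫ x in Ω, (inner ℝ (G x) (deriv Ψ (z x) • Z x) -
            inner ℝ (G' x) (deriv Ψ (z x) • Z x)) := by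
          refine integral_congr_ae (Eventually.of_forall fun x => ?_)
          simp only
          rw [← inner_sub_left, inner_smul_right, ← real_inner_self_eq_norm_sq]
      _ = _ := by
          rw [integral_sub hi hi']
          linarith
  rw [hsum, mul_add]
  have h1 := abs_le.1 (hbd hρi)
  have h2 := abs_le.1 (hbd hρi')
  linarith [h1.2, h2.1]

/-! ### Hölder estimates and exponents -/

section Holder

variable {α : Type*} [MeasurableSpace α] {μ : Measure α} {z w : α → ℝ} {β κ : ℝ}

/-- The pointwise bound `bracket_le_of_le` is integrated; the `Lᵐ` norm of `|w|^κ` is the `κ`-th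
power of the `L^(mκ)` norm of `w`. -/
lemma eLpNorm_bracket_le (hw : AEStronglyMeasurable w μ)
    (hβ0 : 0 < β) (hβ : β < 1 / 2) (hκ : (1 / 2 - β) * κ = β)
    (hzw : ∀ x, |z x| * (1 + z x ^ 2) ^ (-β) ≤ |w x|) {m : ℝ≥0∞} (hm : 1 ≤ m) (hmt : m ≠ ⊤) :
    eLpNorm (fun x => (1 + z x ^ 2) ^ β) m μ ≤
      ENNReal.ofReal (2 ^ β) * μ univ ^ (1 / m.toReal) +
        ENNReal.ofReal (√2 ^ κ) * eLpNorm w (m * ENNReal.ofReal κ) μ ^ κ := by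
  have hκ0 : 0 < κ := by
    by_contra! h
    nlinarith
  have h1 : eLpNorm (fun x => (1 + z x ^ 2) ^ β) m μ ≤
      eLpNorm ((fun _ => (2 : ℝ) ^ β) + fun x => √2 ^ κ * ‖w x‖ ^ κ) m μ := by
    refine eLpNorm_mono_real fun x => ?_
    rw [Real.norm_of_nonneg (by positivity), Pi.add_apply, Real.norm_eq_abs,
      ← Real.mul_rpow (by positivity) (by positivity)]
    exact bracket_le_of_le hβ0 hβ hκ (hzw x)
  have hwm : AEStronglyMeasurable (fun x => ‖w x‖ ^ κ) μ :=
    (hw.norm.aemeasurable.pow_const κ).aestronglyMeasurable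
  refine h1.trans ((eLpNorm_add_le aestronglyMeasurable_const (hwm.const_mul _) hm).trans ?_)
  refine add_le_add (le_of_eq ?_) (le_of_eq ?_)
  · rw [eLpNorm_const' _ (by positivity) hmt, Real.enorm_of_nonneg (by positivity)]
  · have h2 := eLpNorm_const_smul (√2 ^ κ) (fun x => ‖w x‖ ^ κ) m μ
    rw [eLpNorm_norm_rpow w hκ0, Real.enorm_of_nonneg (by positivity)] at h2
    exact h2

/-- Pointwise `|z| ≤ ((1 + z²)^β)^(1/(2β))`, so the exponent needed for the bracket is `q/(2β)`. It
is at most `2q ≤ m` because `β > 1/4`, and raising it to `m` costs a power of the total mass. -/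
lemma eLpNorm_le_of_bracket (hz : AEStronglyMeasurable z μ) (hβ0 : 1 / 4 < β) {q m : ℝ}
    (hq : 1 ≤ q) (hm : 2 * q ≤ m) :
    eLpNorm z (ENNReal.ofReal q) μ ≤
      (eLpNorm (fun x => (1 + z x ^ 2) ^ β) (ENNReal.ofReal m) μ *
        μ univ ^ (1 / (q * (1 / (2 * β))) - 1 / m)) ^ (1 / (2 * β)) := by
  have hγ0 : 0 < 1 / (2 * β) := by
    have : 0 < 2 * β := by linarith
    positivity
  have hγ2 : 1 / (2 * β) ≤ 2 := by
    rw [div_le_iff₀ (by linarith)]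
    linarith
  have hYm : AEStronglyMeasurable (fun x => (1 + z x ^ 2) ^ β) μ :=
    (continuous_bracket β).comp_aestronglyMeasurable hz
  have h1 : eLpNorm z (ENNReal.ofReal q) μ ≤
      eLpNorm (fun x => ‖(1 + z x ^ 2) ^ β‖ ^ (1 / (2 * β))) (ENNReal.ofReal q) μ := by
    refine eLpNorm_mono_real fun x => ?_
    have hY : ‖(1 + z x ^ 2) ^ β‖ = (1 + z x ^ 2) ^ β := Real.norm_of_nonneg (by positivity)
    rw [hY, ← Real.rpow_mul (by positivity), show β * (1 / (2 * β)) = 1 / 2 by field_simp, ← Real.sqrt_eq_rpow, Real.norm_eq_abs]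
    exact Real.abs_le_sqrt (by linarith)
  refine h1.trans ?_
  rw [eLpNorm_norm_rpow _ hγ0, ← ENNReal.ofReal_mul (by linarith)]
  refine ENNReal.rpow_le_rpow ?_ hγ0.le
  have hqm : q * (1 / (2 * β)) ≤ m := by nlinarith
  have h2 := eLpNorm_le_eLpNorm_mul_rpow_measure_univ (ENNReal.ofReal_le_ofReal hqm) hYm
  rwa [ENNReal.toReal_ofReal (by positivity), ENNReal.toReal_ofReal (by linarith)] at h2

/-- Multiplying and dividing by the weight `(1 + z²)^β` recovers the unweighted gradient from the
weighted energy. -/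
lemma eLpNorm_le_eLpNorm_bracket_mul {F : Type*} [NormedAddCommGroup F] [NormedSpace ℝ F]
    {Z : α → F} (hz : AEStronglyMeasurable z μ) (hZ : AEStronglyMeasurable Z μ) {q m : ℝ}
    (hq : 0 < q) (hm : 0 < m) (hqm : 1 / q = 1 / m + 1 / 2) :
    eLpNorm Z (ENNReal.ofReal q) μ ≤
      eLpNorm (fun x => (1 + z x ^ 2) ^ β) (ENNReal.ofReal m) μ *
        eLpNorm (fun x => (1 + z x ^ 2) ^ (-β) • Z x) 2 μ := by
  have : ENNReal.HolderTriple (ENNReal.ofReal m) 2 (ENNReal.ofReal q) := ⟨by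
    rw [← ENNReal.ofReal_inv_of_pos hm, ← ENNReal.ofReal_inv_of_pos hq,
      show (2 : ℝ≥0∞)⁻¹ = ENNReal.ofReal (1 / 2) by
        rw [one_div, ENNReal.ofReal_inv_of_pos (by norm_num)]; norm_num,
      ← ENNReal.ofReal_add (by positivity) (by norm_num)]
    congr 1
    rw [inv_eq_one_div, inv_eq_one_div, hqm]⟩
  have hYm : ∀ b : ℝ, AEStronglyMeasurable (fun x => (1 + z x ^ 2) ^ b) μ := fun b =>
    (continuous_bracket b).comp_aestronglyMeasurable hz
  have e : Z = (fun x => (1 + z x ^ 2) ^ β) • fun x => (1 + z x ^ 2) ^ (-β) • Z x := by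
    ext x
    rw [Pi.smul_apply', smul_smul, ← Real.rpow_add (by positivity), add_neg_cancel,
      Real.rpow_zero, one_smul]
  conv_lhs => rw [e]
  exact eLpNorm_smul_le_mul_eLpNorm ((hYm _).smul hZ) (hYm _)

end Holder

/-- Solving the Hölder relation gives `m = 2q/(2 - q)`, and `q < N/(N-1)` becomes `1/m > 1/2 - 1/N`.
Hence some subcritical `p = 1/t` exceeds `m`. Then `κ = p/m > 1`, and `β = κ/(2(1 + κ))` solves
`(1/2 - β)κ = β`; the condition `κ > 1` is precisely `β > 1/4`. -/
lemma exists_exponents {N : ℕ} (hN : 3 ≤ N) {q : ℝ} (hq : 1 ≤ q)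
    (hqN : q < (N : ℝ) / ((N : ℝ) - 1)) :
    ∃ m p β κ : ℝ, 0 < m ∧ 1 / q = 1 / m + 1 / 2 ∧ 2 * q ≤ m ∧ 2 ≤ p ∧
      1 / 2 - 1 / (N : ℝ) < 1 / p ∧ 1 / 4 < β ∧ β < 1 / 2 ∧ (1 / 2 - β) * κ = β ∧ 0 < κ ∧
      m * κ = p := by
  have hN3 : (3 : ℝ) ≤ N := by exact_mod_cast hN
  have hq0 : 0 < q := by linarith
  have h1 : q * (N - 1) < N := by rwa [lt_div_iff₀ (by linarith)] at hqN
  have hq2 : q < 2 := by nlinarith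
  set m := 2 * q / (2 - q) with hm
  have hm0 : 0 < m := div_pos (by linarith) (by linarith)
  have hmq : 1 / q = 1 / m + 1 / 2 := by
    rw [hm]
    have : 2 - q ≠ 0 := by linarith
    field_simp
    ring
  have h2qm : 2 * q ≤ m := by
    rw [hm, le_div_iff₀ (by linarith)]
    nlinarith
  have h2 : 1 / 2 - 1 / (N : ℝ) < 1 / m := by
    have h3 : 1 - 1 / (N : ℝ) < 1 / q := by
      rw [lt_div_iff₀ hq0]
      have : (1 - 1 / (N : ℝ)) * q = q * (N - 1) / N := by
        field_simp
      rw [this, div_lt_one (by linarith)]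
      exact h1
    linarith
  obtain ⟨t, ht1, ht2⟩ := exists_between h2
  have ht0 : 0 < t := by
    have : 1 / (N : ℝ) ≤ 1 / 2 := one_div_le_one_div_of_le (by norm_num) (by linarith)
    linarith
  have hmp : m < 1 / t := by
    rw [lt_div_iff₀ ht0]
    rw [lt_div_iff₀ hm0] at ht2
    linarith
  set κ := 1 / t / m with hκ
  have hκ1 : 1 < κ := by rwa [hκ, one_lt_div hm0]
  refine ⟨m, 1 / t, κ / (2 * (1 + κ)), κ, hm0, hmq, h2qm, by linarith, by rwa [one_div_one_div],
    ?_, ?_, ?_, by linarith, ?_⟩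
  · rw [div_lt_div_iff₀ (by norm_num) (by linarith)]
    linarith
  · rw [div_lt_div_iff₀ (by linarith) (by norm_num)]
    linarith
  · have : 1 + κ ≠ 0 := by linarith
    field_simp
    ring
  · rw [hκ, mul_div_cancel₀ _ hm0.ne']

/-! ### The uniform bound in `W^{1,q}` -/

lemma MemW1.mono_exponent {N : ℕ} {Ω : Set (E N)} (hΩ : Bornology.IsBounded Ω) {p q : ℝ≥0∞}
    (hpq : p ≤ q) {u : E N → ℝ} (hu : MemW1 Ω q u) : MemW1 Ω p u := by
  have := isFiniteMeasure_restrict_of_isBounded hΩ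
  obtain ⟨hu, G, hG, hG'⟩ := hu
  exact ⟨hu.mono_exponent hpq, G, hG, hG'.mono_exponent hpq⟩

lemma MemW1.w1Norm_ne_top {N : ℕ} {Ω : Set (E N)} {p : ℝ≥0∞} {u : E N → ℝ} (hu : MemW1 Ω p u) :
    w1Norm Ω p u ≠ ⊤ := by
  obtain ⟨hu, G, hG, hG'⟩ := hu
  refine ne_top_of_le_ne_top ?_ (hG.w1Norm_le p)
  exact ENNReal.add_ne_top.2 ⟨hu.eLpNorm_ne_top,
    ENNReal.mul_ne_top (ENNReal.natCast_ne_top N) hG'.eLpNorm_ne_top⟩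

/-- Differences of solutions with the same boundary data are bounded in `W^{1,q}(Ω)`, in terms of
the total variation of the sources only. -/
lemma exists_w1Norm_sub_le {N : ℕ} (hN : 3 ≤ N) {Ω Γ₁ Γ₂ : Set (E N)}
    (hΩ : IsBoundedLipschitzDomain Ω) (hΓ : IsBoundaryDecomposition Ω Γ₁ Γ₂)
    (hΓ₁ : 0 < surf Ω Γ₁) {q : ℝ} (hq : 1 ≤ q) (hqN : q < (N : ℝ) / ((N : ℝ) - 1)) (V : ℝ≥0) :
    ∃ C : ℝ≥0, ∀ (f₁ : E N → ℝ) (f₂ : HNegHalf Ω Γ₂) (ρ ρ' u u' : E N → ℝ),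
      MemLp ρ ⊤ (volume.restrict Ω) → MemLp ρ' ⊤ (volume.restrict Ω) →
      eLpNorm ρ 1 (volume.restrict Ω) ≤ V → eLpNorm ρ' 1 (volume.restrict Ω) ≤ V →
      IsMixedSolution Ω Γ₁ Γ₂ ρ f₁ f₂ u → IsMixedSolution Ω Γ₁ Γ₂ ρ' f₁ f₂ u' →
        w1Norm Ω (ENNReal.ofReal q) (fun x => u x - u' x) ≤ C := by
  have hfin := isFiniteMeasure_restrict_of_isBounded hΩ.isBounded
  obtain ⟨m, p, β, κ, hm0, hqm, h2qm, hp2, hpN, hβ4, hβ2, hβκ, hκ0, hmκ⟩ :=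
    exists_exponents hN hq hqN
  have hβ0 : 0 < β := by linarith
  have hΓsub : Γ₁ ⊆ frontier Ω := by
    rw [← hΓ.closure_right]
    exact subset_union_left
  obtain ⟨CS, hCS⟩ := hΩ.poincare_sobolev_of_hasTrace hN hp2 hpN hΓsub hΓ₁
  obtain ⟨M, hM⟩ := exists_abs_bracketPrim_le (a := 2 * β) (by linarith)
  set μΩ : Measure (E N) := volume.restrict Ω with hμΩ
  have hvt : μΩ univ ≠ ⊤ := measure_ne_top _ _
  -- bounds for `∇w` in `L²`, for the bracket in `Lᵐ`, and for `z` in `L^q`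
  set D : ℝ≥0∞ := ENNReal.ofReal ((M * (V + V) : ℝ) ^ (1 / 2 : ℝ)) with hD
  set Y : ℝ≥0∞ := ENNReal.ofReal (2 ^ β) * μΩ univ ^ (1 / (ENNReal.ofReal m).toReal) +
    ENNReal.ofReal (√2 ^ κ) * (CS * D) ^ κ with hY
  set Q : ℝ≥0∞ := (Y * μΩ univ ^ (1 / (q * (1 / (2 * β))) - 1 / m)) ^ (1 / (2 * β)) with hQ
  have hYt : Y ≠ ⊤ := by
    refine ENNReal.add_ne_top.2 ⟨ENNReal.mul_ne_top ENNReal.ofReal_ne_top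
      (ENNReal.rpow_ne_top_of_nonneg (by positivity) hvt), ENNReal.mul_ne_top ENNReal.ofReal_ne_top
      (ENNReal.rpow_ne_top_of_nonneg hκ0.le
        (ENNReal.mul_ne_top ENNReal.coe_ne_top ENNReal.ofReal_ne_top))⟩
  have hQt : Q ≠ ⊤ := by
    refine ENNReal.rpow_ne_top_of_nonneg (by positivity) (ENNReal.mul_ne_top hYt
      (ENNReal.rpow_ne_top_of_nonneg ?_ hvt))
    rw [sub_nonneg]
    refine one_div_le_one_div_of_le (by positivity) ?_
    have : 1 / (2 * β) ≤ 2 := by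
      rw [div_le_iff₀ (by linarith)]
      linarith
    nlinarith
  have hCt : Q + N * (Y * D) ≠ ⊤ := ENNReal.add_ne_top.2 ⟨hQt,
    ENNReal.mul_ne_top (ENNReal.natCast_ne_top N) (ENNReal.mul_ne_top hYt ENNReal.ofReal_ne_top)⟩
  refine ⟨(Q + N * (Y * D)).toNNReal, fun f₁ f₂ ρ ρ' u u' hρ hρ' hρV hρV' hu hu' => ?_⟩
  rw [ENNReal.coe_toNNReal hCt]
  obtain ⟨Z, g, htr, hZ, hZ2, hg0, hen⟩ := hu.exists_energy_le hΩ hΓ hρ hρ' hu'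
  set z : E N → ℝ := fun x => u x - u' x with hz
  have hzm : AEStronglyMeasurable z μΩ := htr.1.1.aestronglyMeasurable
  obtain ⟨hwT, hwG⟩ := htr.comp hΩ.isOpen hΩ.isBounded hZ (contDiff_bracketPrim β)
    (lipschitzWith_bracketPrim hβ0.le) (bracketPrim_zero β)
  have hW2 := hwT.1.memLp_of_hasWeakGradient hΩ.isOpen hwG
  simp only [deriv_bracketPrim] at hwG hW2
  have hw0 : ((lipschitzWith_bracketPrim hβ0.le).compLp (bracketPrim_zero β) g :
      Lp ℝ 2 (surf Ω)) =ᵐ[(surf Ω).restrict Γ₁] 0 := by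
    filter_upwards [ae_restrict_of_ae ((lipschitzWith_bracketPrim hβ0.le).coeFn_compLp
      (bracketPrim_zero β) g), hg0] with x h1 h2
    rw [h1, Function.comp_apply, h2, Pi.zero_apply, bracketPrim_zero]
  have hWD : eLpNorm (fun x => (1 + z x ^ 2) ^ (-β) • Z x) 2 μΩ ≤ D := by
    have hV : ∀ {r : E N → ℝ}, MemLp r ⊤ μΩ → eLpNorm r 1 μΩ ≤ V → ∫ x, ‖r x‖ ∂μΩ ≤ V := by
      intro r hr hrV
      rw [integral_norm_eq_lintegral_enorm hr.aestronglyMeasurable]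
      rw [eLpNorm_one_eq_lintegral_enorm] at hrV
      exact ENNReal.toReal_le_coe_of_le_coe hrV
    -- The derivative `(1 + z²)^(-2β)` of this test function is the square of the weight in `∇w`, so
    -- the energy is `‖∇w‖₂²`. It is bounded by `M` since `2β > 1/2`.
    have h1 := hen (bracketPrim (2 * β)) 1 M (contDiff_bracketPrim _)
      (lipschitzWith_bracketPrim (by linarith)) (bracketPrim_zero _) hM
    have h2 : ∫ x, deriv (bracketPrim (2 * β)) (u x - u' x) * ‖Z x‖ ^ 2 ∂μΩ ≤ M * (V + V) :=
      h1.trans (mul_le_mul_of_nonneg_left (add_le_add (hV hρ hρV) (hV hρ' hρV')) M.2)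
    rw [hW2.eLpNorm_eq_integral_rpow_norm (by norm_num) (by norm_num), hD]
    refine ENNReal.ofReal_le_ofReal ?_
    rw [show ((2 : ℝ≥0∞).toReal)⁻¹ = 1 / 2 by norm_num]
    refine Real.rpow_le_rpow (integral_nonneg fun _ => by positivity) (le_trans (le_of_eq ?_) h2)
      (by norm_num)
    refine integral_congr_ae (Eventually.of_forall fun x => ?_)
    simp only [deriv_bracketPrim, ENNReal.toReal_ofNat, Real.rpow_ofNat]
    rw [norm_smul, mul_pow, Real.norm_of_nonneg (by positivity), ← Real.rpow_mul_natCast (by positivity)]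
    congr 2
    push_cast
    ring
  have hwp : eLpNorm (fun x => bracketPrim β (z x)) (ENNReal.ofReal p) μΩ ≤ CS * D :=
    (hCS _ _ _ hwT hwG hw0).trans (mul_le_mul_right hWD _)
  have hYle : eLpNorm (fun x => (1 + z x ^ 2) ^ β) (ENNReal.ofReal m) μΩ ≤ Y := by
    refine (eLpNorm_bracket_le hwT.1.1.aestronglyMeasurable hβ0 hβ2 hβκ
      (fun x => le_abs_bracketPrim hβ0.le (z x)) ?_ ENNReal.ofReal_ne_top).trans ?_
    · rw [ENNReal.one_le_ofReal]
      linarith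
    · rw [← ENNReal.ofReal_mul hm0.le, hmκ, hY]
      gcongr
  refine (hZ.w1Norm_le _).trans (add_le_add ?_ (mul_le_mul_right ?_ _))
  · refine (eLpNorm_le_of_bracket hzm hβ4 hq h2qm).trans ?_
    rw [hQ]
    gcongr
  · refine (eLpNorm_le_eLpNorm_bracket_mul (β := β) hzm hZ2.aestronglyMeasurable (by linarith) hm0
      hqm).trans ?_
    exact mul_le_mul' hYle hWD

end MixedPoisson

end

theorem mainTheorem9 {N : ℕ} (hN : 3 ≤ N) (Ω Γ₁ Γ₂ : Set (MixedPoisson.E N))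
    (hΩ : MixedPoisson.IsBoundedLipschitzDomain Ω)
    (hΓ : MixedPoisson.IsBoundaryDecomposition Ω Γ₁ Γ₂)
    (hΓ₁ : 0 < MixedPoisson.surf Ω Γ₁)
    (f₁ : MixedPoisson.E N → ℝ) (hf₁ : MixedPoisson.MemHHalfOn Ω Γ₁ f₁)
    (f₂ : MixedPoisson.HNegHalf Ω Γ₂)
    (μ : ℕ → MixedPoisson.E N → ℝ) (hμ : ∀ n, MemLp (μ n) ∞ (volume.restrict Ω))
    (hμ_bdd : MixedPoisson.BoundedVariation Ω μ ∨ ∃ ν, MixedPoisson.WeakStarTendsto Ω μ ν)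
    (u : ℕ → MixedPoisson.E N → ℝ)
    (hu : ∀ n, MixedPoisson.IsMixedSolution Ω Γ₁ Γ₂ (μ n) f₁ f₂ (u n)) :
    ∀ q : ℝ, 1 ≤ q → q < (N : ℝ) / ((N : ℝ) - 1) →
      ∃ C : ℝ≥0, ∀ n, MixedPoisson.MemW1 Ω (ENNReal.ofReal q) (u n) ∧
        MixedPoisson.w1Norm Ω (ENNReal.ofReal q) (u n) ≤ C := by
  intro q hq hqN
  obtain ⟨V, hV⟩ : MixedPoisson.BoundedVariation Ω μ := by
    rcases hμ_bdd with h | ⟨ν, h⟩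
    · exact h
    · exact h.boundedVariation hΩ.isBounded hμ
  have hN3 : (3 : ℝ) ≤ N := by exact_mod_cast hN
  have hq2 : ENNReal.ofReal q ≤ 2 := by
    rw [lt_div_iff₀ (by linarith)] at hqN
    have h : q ≤ 2 := by nlinarith
    simpa using ENNReal.ofReal_le_ofReal h
  have hW : ∀ n, MixedPoisson.MemW1 Ω (ENNReal.ofReal q) (u n) := fun n =>
    (hu n).memH1.mono_exponent hΩ.isBounded hq2
  -- Comparison with `u 0` removes the boundary data: `f₁` and `f₂` enter the final constant only
  -- through the norm of `u 0`.
  obtain ⟨C, hC⟩ := MixedPoisson.exists_w1Norm_sub_le hN hΩ hΓ hΓ₁ hq hqN V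
  refine ⟨C + (MixedPoisson.w1Norm Ω (ENNReal.ofReal q) (u 0)).toNNReal, fun n => ⟨hW n, ?_⟩⟩
  rw [ENNReal.coe_add, ENNReal.coe_toNNReal (hW 0).w1Norm_ne_top]
  have h := MixedPoisson.w1Norm_add_le (Ω := Ω) (ENNReal.one_le_ofReal.2 hq)
    (fun x => u n x - u 0 x) (u 0)
  simp only [sub_add_cancel] at h
  exact h.trans (add_le_add (hC f₁ f₂ _ _ _ _ (hμ n) (hμ 0) (hV n) (hV 0) (hu n) (hu 0)) le_rfl)
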